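/- Let $n \ge 0$ and let $F_n$ be the free group on $x_1,\dots,x_n$. For a group $G$ let $\Gamma^1(G)=G$, $\Gamma^{s+1}(G)=[G,\Gamma^s(G)]$, $gr_s^{DCS}(G)=\Gamma^s(G)/\Gamma^{s+1}(G)$; the direct sum $\bigoplus_{s\ge1} gr_s^{DCS}(G)$ is a Lie algebra over $\mathbb Z$ with bracket induced by the commutator. Let $J_n^s\subset \mathrm{Aut}(F_n)$ be the subgroup of automorphisms inducing the identity on $F_n/\Gamma^{s+1}(F_n)$, so $J_n^1=IA_n$, and let $\bigoplus_{s\ge 1} gr^J_s(IA_n)=\bigoplus_{s\ge1} J_n^s/J_n^{s+1}$, a Lie algebra with bracket induced by the commutator. Let $L[V_n]=\bigoplus_{s\ge1}L_s[V_n]$ be the free Lie algebra over $\mathbb Z$ on $V_n=H_1(F_n)\cong\mathbb Z^n$, with basis the classes of $x_1,\dots,x_n$; the canonical Lie algebra map $L[V_n]\to\bigoplus_{s\ge1} gr_s^{DCS}(F_n)$ is an isomorphism (Hall, Witt), used to identify $L_s[V_n]=\Gamma^s(F_n)/\Gamma^{s+1}(F_n)$. Let $Der(L[V_n])=\bigoplus_{s\ge1}Der_s(L[V_n])$,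 where $Der_s(L[V_n])\cong Hom(V_n,L_{s+1}[V_n])$ is the group of derivations of $L[V_n]$ raising degree by $s$, with bracket $[D,E]=DE-ED$. The Johnson homomorphisms $\tau_s: gr_s^J(IA_n)\to Der_s(L[V_n])$, where $\tau_s([\varphi])$ is the derivation sending $x_i$ to the class of $\varphi(x_i)x_i^{-1}$ in $L_{s+1}[V_n]$, together form a morphism of Lie algebras $\bigoplus_s gr^J_s(IA_n)\to Der(L[V_n])$. Let $P\Sigma_n^+\subset IA_n$ be the upper triangular McCool group, generated by the automorphisms $\alpha_{ij}$, $1\le j<i\le n$, with $\alpha_{ij}(x_i)=x_jx_ix_j^{-1}$ and $\alpha_{ij}(x_r)=x_r$ for $r\ne i$. Then the composite morphism of Lie algebras $$J:\bigoplus_{s\ge1} gr_s^{DCS}(P\Sigma_n^+)\longrightarrow\bigoplus_{s\ge1} gr_s^J(IA_n)\longrightarrow Der(L[V_n]),$$ whose first map is induced by the inclusion $P\Sigma_n^+\subset IA_n$ and whose second map is given by the Johnson homomorphisms, is injective, and it is split injective as a map of abelian groups (there is a homomorphism of abelian groups $r$ with $r\circ J=\mathrm{id}$). If $n\ge3$,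 it is not split as a map of Lie algebras: there is no Lie algebra homomorphism $r: Der(L[V_n])\to\bigoplus_{s\ge1} gr_s^{DCS}(P\Sigma_n^+)$ with $r\circ J=\mathrm{id}$. -/

import Mathlib

open scoped commutatorElement

noncomputable section

/-! ### The Lie ring of a central filtration of a group -/

/-- A descending filtration `term 1 ≥ term 2 ≥ ⋯` by subgroups of `G` such that
`[term i, term j] ≤ term (i + j)`. -/
structure NSeries (G : Type*) [Group G] where
  term : ℕ+ → Subgroup G
  antitone_term : Antitone term
  commutator_le : ∀ i j, ⁅term i, term j⁆ ≤ term (i + j)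

namespace NSeries

variable {G : Type*} [Group G] (Γ : NSeries G)

theorem succ_le (s : ℕ+) : Γ.term (s + 1) ≤ Γ.term s :=
  Γ.antitone_term (PNat.lt_add_right s 1).le

theorem comm_mem {i j : ℕ+} {x y : G} (hx : x ∈ Γ.term i) (hy : y ∈ Γ.term j) :
    ⁅x, y⁆ ∈ Γ.term (i + j) :=
  Γ.commutator_le i j (Subgroup.commutator_mem_commutator hx hy)

theorem comm_mem_succ {i j : ℕ+} {x y : G} (hx : x ∈ Γ.term i) (hy : y ∈ Γ.term j) :
    ⁅x, y⁆ ∈ Γ.term (j + 1) :=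
  Γ.antitone_term (by rw [add_comm i j]; exact add_le_add le_rfl one_le) (Γ.comm_mem hx hy)

instance normal_succ (s : ℕ+) : ((Γ.term (s + 1)).subgroupOf (Γ.term s)).Normal where
  conj_mem := by
    rintro ⟨a, ha'⟩ ha ⟨g, hg⟩
    rw [Subgroup.mem_subgroupOf] at ha ⊢
    have h1 : g * a * g⁻¹ = ⁅g, a⁆ * a := by simp [commutatorElement_def]
    change g * a * g⁻¹ ∈ _
    rw [h1]
    exact mul_mem (Γ.comm_mem_succ hg ha') ha

/-- The quotient `term s / term (s + 1)`, written multiplicatively. -/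
abbrev QuotPiece (s : ℕ+) : Type _ := Γ.term s ⧸ (Γ.term (s + 1)).subgroupOf (Γ.term s)

instance commGroupQuot (s : ℕ+) : CommGroup (Γ.QuotPiece s) where
  mul_comm := by
    intro a b
    induction a using QuotientGroup.induction_on with | _ a
    induction b using QuotientGroup.induction_on with | _ b
    rw [← QuotientGroup.mk_mul, ← QuotientGroup.mk_mul, QuotientGroup.eq,
      Subgroup.mem_subgroupOf]
    have h1 : (((a * b)⁻¹ * (b * a) : Γ.term s) : G) = ⁅(b : G)⁻¹, (a : G)⁻¹⁆ := by
      simp [commutatorElement_def, mul_assoc]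
    rw [h1]
    exact Γ.comm_mem_succ (inv_mem b.2) (inv_mem a.2)

/-- The graded piece `gr_s = term s / term (s + 1)`, an abelian group written additively. -/
def Piece (s : ℕ+) : Type _ := Additive (Γ.QuotPiece s)

instance (s : ℕ+) : AddCommGroup (Γ.Piece s) := inferInstanceAs (AddCommGroup (Additive (Γ.QuotPiece s)))

/-- The associated graded abelian group `⨁_{s ≥ 1} term s / term (s + 1)`. -/
def Gr : Type _ := DirectSum ℕ+ Γ.Piece

instance : AddCommGroup Γ.Gr := inferInstanceAs (AddCommGroup (DirectSum ℕ+ Γ.Piece))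

/-- The inclusion of the graded piece of degree `s`. -/
def ofPiece (s : ℕ+) : Γ.Piece s →+ Γ.Gr := DirectSum.of Γ.Piece s

/-- An additive map on the associated graded group from additive maps on the pieces. -/
def liftGr {A : Type*} [AddCommGroup A] (φ : ∀ s, Γ.Piece s →+ A) : Γ.Gr →+ A :=
  DirectSum.toAddMonoid φ

theorem liftGr_ofPiece {A : Type*} [AddCommGroup A] (φ : ∀ s, Γ.Piece s →+ A) (s : ℕ+)
    (a : Γ.Piece s) : Γ.liftGr φ (Γ.ofPiece s a) = φ s a :=
  DirectSum.toAddMonoid_of φ s a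

/-- The class of `x ∈ term s` in `term s / term (s + 1)`. -/
def pieceMk (s : ℕ+) (x : Γ.term s) : Γ.Piece s := Additive.ofMul (QuotientGroup.mk x : Γ.QuotPiece s)

/-- The class in `term s / term (s + 1)`, as an element of the associated graded group, of an
element `x` of `term s`. -/
def cls (s : ℕ+) (x : G) (hx : x ∈ Γ.term s) : Γ.Gr := Γ.ofPiece s (Γ.pieceMk s ⟨x, hx⟩)

theorem cls_mul {s : ℕ+} {x y : G} (hx : x ∈ Γ.term s) (hy : y ∈ Γ.term s) :
    Γ.cls s (x * y) (mul_mem hx hy) = Γ.cls s x hx + Γ.cls s y hy :=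
  map_add (Γ.ofPiece s) (Γ.pieceMk s ⟨x, hx⟩) (Γ.pieceMk s ⟨y, hy⟩)

theorem cls_one (s : ℕ+) : Γ.cls s 1 (one_mem _) = 0 :=
  map_zero (Γ.ofPiece s)

theorem cls_congr {s t : ℕ+} {x y : G} (hst : s = t) (hxy : x = y) (hx : x ∈ Γ.term s)
    (hy : y ∈ Γ.term t) : Γ.cls s x hx = Γ.cls t y hy := by
  subst hst hxy; rfl

theorem cls_eq {s : ℕ+} {x y : G} (hx : x ∈ Γ.term s) (hy : y ∈ Γ.term s)
    (h : x⁻¹ * y ∈ Γ.term (s + 1)) : Γ.cls s x hx = Γ.cls s y hy := by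
  unfold cls pieceMk
  congr 2
  rw [QuotientGroup.eq, Subgroup.mem_subgroupOf]
  exact h

theorem cls_conj {i s : ℕ+} {g x : G} (hg : g ∈ Γ.term i) (hx : x ∈ Γ.term s)
    (h : g * x * g⁻¹ ∈ Γ.term s) : Γ.cls s (g * x * g⁻¹) h = Γ.cls s x hx := by
  refine Γ.cls_eq _ _ ?_
  have h1 : (g * x * g⁻¹)⁻¹ * x = ⁅g, x⁻¹⁆ := by simp [commutatorElement_def, mul_assoc]
  rw [h1]
  exact Γ.comm_mem_succ hg (inv_mem hx)

@[elab_as_elim]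
theorem gr_induction {P : Γ.Gr → Prop} (a : Γ.Gr) (zero : P 0)
    (cls : ∀ s x hx, P (Γ.cls s x hx)) (add : ∀ a b, P a → P b → P (a + b)) : P a := by
  refine DirectSum.induction_on a zero (fun s q => ?_) add
  obtain ⟨⟨x, hx⟩, rfl⟩ := QuotientGroup.mk_surjective (Additive.toMul q)
  exact cls s x hx

/-- For `x ∈ term i`, the homomorphism `term j → gr_{i+j}`, `y ↦ [x, y]`. -/
def commHom (i j : ℕ+) (x : Γ.term i) : Γ.term j →* Γ.QuotPiece (i + j) :=
  MonoidHom.mk' (fun y => QuotientGroup.mk ⟨⁅(x : G), (y : G)⁆, Γ.comm_mem x.2 y.2⟩) <| by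
    intro y z
    rw [← QuotientGroup.mk_mul, QuotientGroup.eq, Subgroup.mem_subgroupOf]
    have hxz := Γ.comm_mem x.2 z.2
    have h1 : (⁅(x : G), (y : G) * z⁆)⁻¹ * (⁅(x : G), (y : G)⁆ * ⁅(x : G), (z : G)⁆)
        = ⁅(y : G), ⁅(x : G), (z : G)⁆⁻¹⁆ := by
      simp [commutatorElement_def, mul_assoc]
    change (⁅(x : G), (y : G) * z⁆)⁻¹ * (⁅(x : G), (y : G)⁆ * ⁅(x : G), (z : G)⁆) ∈ _
    rw [h1]
    exact Γ.comm_mem_succ y.2 (inv_mem hxz)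

/-- For `x ∈ term i`, the homomorphism `gr_j → gr_{i+j}` induced by `y ↦ [x, y]`. -/
def commHomRight (i j : ℕ+) (x : Γ.term i) : Γ.QuotPiece j →* Γ.QuotPiece (i + j) :=
  QuotientGroup.lift _ (Γ.commHom i j x) <| by
    intro y hy
    rw [MonoidHom.mem_ker]
    refine (QuotientGroup.eq_one_iff _).2 ?_
    rw [Subgroup.mem_subgroupOf] at hy ⊢
    exact (add_assoc i j 1).symm ▸ Γ.comm_mem x.2 hy

/-- The homomorphism `gr_i → Hom(gr_j, gr_{i+j})` induced by the commutator. -/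
def commHomLeft (i j : ℕ+) : Γ.QuotPiece i →* (Γ.QuotPiece j →* Γ.QuotPiece (i + j)) :=
  QuotientGroup.lift _ (MonoidHom.mk' (Γ.commHomRight i j) (by
    intro x y
    ext z
    change (QuotientGroup.mk _ : Γ.QuotPiece (i + j)) = QuotientGroup.mk _ * QuotientGroup.mk _
    rw [← QuotientGroup.mk_mul, QuotientGroup.eq, Subgroup.mem_subgroupOf]
    have hyz := Γ.comm_mem y.2 z.2
    have hxz := Γ.comm_mem x.2 z.2
    have h1 : (⁅(x : G) * y, (z : G)⁆)⁻¹ * (⁅(x : G), (z : G)⁆ * ⁅(y : G), (z : G)⁆)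
        = ⁅⁅(x : G), (z : G)⁆⁻¹ * x, ⁅(y : G), (z : G)⁆⁻¹⁆ := by
      simp [commutatorElement_def, mul_assoc]
    change (⁅(x : G) * y, (z : G)⁆)⁻¹ * (⁅(x : G), (z : G)⁆ * ⁅(y : G), (z : G)⁆) ∈ _
    rw [h1]
    refine Γ.comm_mem_succ (i := i) (mul_mem (inv_mem ?_) x.2) (inv_mem hyz)
    exact Γ.antitone_term (PNat.lt_add_right i j).le hxz)) <| by
    intro x hx
    rw [MonoidHom.mem_ker]
    ext y
    refine (QuotientGroup.eq_one_iff _).2 ?_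
    rw [Subgroup.mem_subgroupOf] at hx ⊢
    have h := Γ.comm_mem hx y.2
    rwa [add_right_comm] at h

/-- The biadditive map `gr_i × gr_j → gr_{i+j}` induced by the commutator. -/
def pieceBracket (i j : ℕ+) : Γ.Piece i →+ Γ.Piece j →+ Γ.Piece (i + j) :=
  AddMonoidHom.mk' (fun a => MonoidHom.toAdditive (Γ.commHomLeft i j (Additive.toMul a))) <| by
    intro a b
    ext c
    exact congrArg Additive.ofMul
      (DFunLike.congr_fun (map_mul (Γ.commHomLeft i j) (Additive.toMul a) (Additive.toMul b))
        (Additive.toMul c))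

/-- The bracket of the associated graded group as a biadditive map. -/
def bracketHom : Γ.Gr →+ Γ.Gr →+ Γ.Gr :=
  Γ.liftGr fun i =>
    (Γ.liftGr fun j =>
      ((AddMonoidHom.compHom (Γ.ofPiece (i + j))).comp (Γ.pieceBracket i j)).flip).flip

theorem bracketHom_cls {i j : ℕ+} {x y : G} (hx : x ∈ Γ.term i) (hy : y ∈ Γ.term j) :
    Γ.bracketHom (Γ.cls i x hx) (Γ.cls j y hy) = Γ.cls (i + j) ⁅x, y⁆ (Γ.comm_mem hx hy) := by
  unfold bracketHom cls
  rw [liftGr_ofPiece, AddMonoidHom.flip_apply, liftGr_ofPiece]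
  rfl

theorem bracketHom_skew (a b : Γ.Gr) : Γ.bracketHom a b + Γ.bracketHom b a = 0 := by
  induction a using Γ.gr_induction with
  | zero => simp
  | add a a' h h' =>
    rw [map_add, map_add, AddMonoidHom.add_apply, add_add_add_comm, h, h', add_zero]
  | cls i x hx =>
    induction b using Γ.gr_induction with
    | zero => simp
    | add b b' h h' =>
      rw [map_add, map_add, AddMonoidHom.add_apply, add_add_add_comm, h, h', add_zero]
    | cls j y hy =>
      have hyx : ⁅y, x⁆ ∈ Γ.term (i + j) := add_comm j i ▸ Γ.comm_mem hy hx
      rw [bracketHom_cls, bracketHom_cls, Γ.cls_congr (add_comm j i) rfl _ hyx, ← Γ.cls_mul,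
        Γ.cls_congr rfl (y := 1) (by rw [← commutatorElement_inv y x, inv_mul_cancel]) _
          (one_mem _), cls_one]

theorem bracketHom_self (a : Γ.Gr) : Γ.bracketHom a a = 0 := by
  induction a using Γ.gr_induction with
  | zero => simp
  | add a a' h h' =>
    rw [map_add, map_add, AddMonoidHom.add_apply, AddMonoidHom.add_apply, h, h', zero_add,
      add_zero, bracketHom_skew]
  | cls i x hx =>
    rw [bracketHom_cls, Γ.cls_congr rfl (commutatorElement_self x) _ (one_mem _), cls_one]

theorem bracketHom_jacobi (a b c : Γ.Gr) :
    Γ.bracketHom (Γ.bracketHom a b) c + Γ.bracketHom (Γ.bracketHom b c) a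
      + Γ.bracketHom (Γ.bracketHom c a) b = 0 := by
  induction a using Γ.gr_induction with
  | zero => simp
  | add a a' h h' =>
    simp only [map_add, AddMonoidHom.add_apply]
    rw [← add_zero (0 : Γ.Gr)]
    nth_rewrite 1 [← h]
    rw [← h']
    abel
  | cls i x hx =>
  induction b using Γ.gr_induction with
  | zero => simp
  | add b b' h h' =>
    simp only [map_add, AddMonoidHom.add_apply]
    rw [← add_zero (0 : Γ.Gr)]
    nth_rewrite 1 [← h]
    rw [← h']
    abel
  | cls j y hy =>
  induction c using Γ.gr_induction with
  | zero => simp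
  | add c c' h h' =>
    simp only [map_add, AddMonoidHom.add_apply]
    rw [← add_zero (0 : Γ.Gr)]
    nth_rewrite 1 [← h]
    rw [← h']
    abel
  | cls k z hz =>
    have conj_mem : ∀ {s t : ℕ+} {g w : G}, g ∈ Γ.term s → w ∈ Γ.term t →
        g * w * g⁻¹ ∈ Γ.term t := by
      intro s t g w hg hw
      have h1 : g * w * g⁻¹ = ⁅g, w⁆ * w := by simp [commutatorElement_def]
      rw [h1]
      exact mul_mem (Γ.succ_le t (Γ.comm_mem_succ hg hw)) hw
    have mx : ⁅⁅y, z⁆, z * x * z⁻¹⁆ ∈ Γ.term (i + j + k) := by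
      have h := Γ.comm_mem (Γ.comm_mem hy hz) (conj_mem hz hx)
      rwa [add_comm, ← add_assoc] at h
    have my : ⁅⁅z, x⁆, x * y * x⁻¹⁆ ∈ Γ.term (i + j + k) := by
      have h := Γ.comm_mem (Γ.comm_mem hz hx) (conj_mem hx hy)
      rwa [add_assoc, add_comm] at h
    have mz := Γ.comm_mem (Γ.comm_mem hx hy) (conj_mem hy hz)
    have key : Γ.cls _ _ mz + Γ.cls _ _ mx + Γ.cls _ _ my = 0 := by
      rw [← Γ.cls_mul mz mx, ← Γ.cls_mul (mul_mem mz mx) my,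
        Γ.cls_congr rfl (commutatorElement_commutatorElement_conj_mul x y z) _ (one_mem _),
        cls_one]
    rw [← Γ.bracketHom_cls (Γ.comm_mem hx hy) (conj_mem hy hz),
      ← Γ.cls_congr (by rw [add_comm, ← add_assoc]) rfl
        (Γ.comm_mem (Γ.comm_mem hy hz) (conj_mem hz hx)) mx,
      ← Γ.cls_congr (by rw [add_assoc, add_comm]) rfl
        (Γ.comm_mem (Γ.comm_mem hz hx) (conj_mem hx hy)) my,
      ← Γ.bracketHom_cls (Γ.comm_mem hy hz) (conj_mem hz hx),
      ← Γ.bracketHom_cls (Γ.comm_mem hz hx) (conj_mem hx hy),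
      Γ.cls_conj, Γ.cls_conj, Γ.cls_conj, ← bracketHom_cls, ← bracketHom_cls,
      ← bracketHom_cls] at key
    · exact key
    all_goals assumption

/-- The Lie ring structure on `⨁_s term s / term (s + 1)`. The bracket is induced by the
commutator `[x, y] = x y x⁻¹ y⁻¹`; as the bracket is biadditive, `x⁻¹ y⁻¹ x y = [x⁻¹, y⁻¹]`
induces the same one. -/
instance : LieRing Γ.Gr where
  bracket a b := Γ.bracketHom a b
  add_lie a b c := by rw [map_add]; rfl
  lie_add a b c := map_add (Γ.bracketHom a) b c
  lie_self a := Γ.bracketHom_self a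
  leibniz_lie a b c := by
    change Γ.bracketHom a (Γ.bracketHom b c)
      = Γ.bracketHom (Γ.bracketHom a b) c + Γ.bracketHom b (Γ.bracketHom a c)
    have h1 := Γ.bracketHom_jacobi a b c
    have h2 := Γ.bracketHom_skew a (Γ.bracketHom b c)
    have h3 := Γ.bracketHom_skew b (Γ.bracketHom a c)
    have h4 : Γ.bracketHom (Γ.bracketHom c a) b = - Γ.bracketHom (Γ.bracketHom a c) b := by
      rw [eq_neg_iff_add_eq_zero, ← AddMonoidHom.add_apply, ← map_add, bracketHom_skew,
        map_zero, AddMonoidHom.zero_apply]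
    rw [eq_neg_of_add_eq_zero_left h2, eq_neg_of_add_eq_zero_left h3, ← h4, neg_eq_iff_add_eq_zero,
      ← h1]
    abel

theorem lie_cls {i j : ℕ+} {x y : G} (hx : x ∈ Γ.term i) (hy : y ∈ Γ.term j) :
    ⁅Γ.cls i x hx, Γ.cls j y hy⁆ = Γ.cls (i + j) ⁅x, y⁆ (Γ.comm_mem hx hy) :=
  Γ.bracketHom_cls hx hy

variable {Γ} {H : Type*} [Group H] {Δ : NSeries H}

/-- The homomorphism `term s / term (s + 1) → term s / term (s + 1)` induced by a group
homomorphism respecting the filtrations. -/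
def mapQuot (f : G →* H) (hf : ∀ s, ∀ x ∈ Γ.term s, f x ∈ Δ.term s) (s : ℕ+) :
    Γ.QuotPiece s →* Δ.QuotPiece s :=
  QuotientGroup.map _ _ ((f.comp (Γ.term s).subtype).codRestrict (Δ.term s) fun x => hf s x x.2)
    fun x hx => hf (s + 1) x hx

/-- The additive map of associated graded groups induced by a group homomorphism respecting the
filtrations. -/
def mapAdd (f : G →* H) (hf : ∀ s, ∀ x ∈ Γ.term s, f x ∈ Δ.term s) : Γ.Gr →+ Δ.Gr :=
  Γ.liftGr fun s =>
    (Δ.ofPiece s).comp (MonoidHom.toAdditive (mapQuot f hf s))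

theorem mapAdd_cls (f : G →* H) (hf : ∀ s, ∀ x ∈ Γ.term s, f x ∈ Δ.term s) {s : ℕ+} {x : G}
    (hx : x ∈ Γ.term s) : mapAdd f hf (Γ.cls s x hx) = Δ.cls s (f x) (hf s x hx) := by
  unfold mapAdd cls
  rw [liftGr_ofPiece]
  rfl

/-- The Lie algebra map of associated graded Lie rings induced by a group homomorphism respecting
the filtrations. -/
def map (f : G →* H) (hf : ∀ s, ∀ x ∈ Γ.term s, f x ∈ Δ.term s) : Γ.Gr →ₗ⁅ℤ⁆ Δ.Gr where
  toLinearMap := (mapAdd f hf).toIntLinearMap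
  map_lie' := by
    intro a b
    change mapAdd f hf ⁅a, b⁆ = ⁅mapAdd f hf a, mapAdd f hf b⁆
    induction a using Γ.gr_induction with
    | zero => simp
    | add a a' h h' => rw [add_lie, map_add, h, h', map_add, add_lie]
    | cls i x hx =>
      induction b using Γ.gr_induction with
      | zero => simp
      | add b b' h h' => rw [lie_add, map_add, h, h', map_add, lie_add]
      | cls j y hy =>
        rw [lie_cls, mapAdd_cls, mapAdd_cls, mapAdd_cls, lie_cls]
        exact Δ.cls_congr rfl (map_commutatorElement f x y) _ _

end NSeries

/-! ### The descending central series -/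

section DCS

variable (G : Type*) [Group G]

/-- `Γ^s(G)` for `s ≥ 1`: `Γ^1(G) = G` and `Γ^{s+1}(G) = [Γ^s(G), G]`. -/
def dcsTerm (s : ℕ+) : Subgroup G := (⊤ : Subgroup G).lowerCentralSeries s.natPred

variable {G}

theorem dcsTerm_one : dcsTerm G 1 = ⊤ := rfl

theorem dcsTerm_succ (s : ℕ+) : dcsTerm G (s + 1) = ⁅dcsTerm G s, (⊤ : Subgroup G)⁆ := by
  unfold dcsTerm
  rw [← Subgroup.lowerCentralSeries_succ]
  congr 1
  have := s.natPred_add_one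
  have := (s + 1).natPred_add_one
  have := PNat.add_coe s 1
  simp only [PNat.one_coe] at this
  omega

instance dcsTerm_normal (s : ℕ+) : (dcsTerm G s).Normal :=
  inferInstanceAs ((⊤ : Subgroup G).lowerCentralSeries _).Normal

theorem dcsTerm_antitone : Antitone (dcsTerm G) := fun s t hst =>
  Subgroup.lowerCentralSeries_antitone _ (Nat.sub_le_sub_right (PNat.coe_le_coe s t |>.2 hst) 1)

theorem commutator_commutator_le_of_rotate {A B C N : Subgroup G} [N.Normal]
    (h1 : ⁅⁅B, C⁆, A⁆ ≤ N) (h2 : ⁅⁅C, A⁆, B⁆ ≤ N) : ⁅⁅A, B⁆, C⁆ ≤ N := by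
  have key : ∀ K : Subgroup G, K ≤ N ↔ K.map (QuotientGroup.mk' N) = ⊥ := by
    intro K
    rw [Subgroup.map_eq_bot_iff, QuotientGroup.ker_mk']
  rw [key, Subgroup.map_commutator, Subgroup.map_commutator] at h1 h2 ⊢
  exact Subgroup.commutator_commutator_eq_bot_of_rotate h1 h2

theorem dcsTerm_commutator_le (i j : ℕ+) :
    ⁅dcsTerm G i, dcsTerm G j⁆ ≤ dcsTerm G (i + j) := by
  induction j using PNat.recOn generalizing i with
  | one => rw [dcsTerm_succ, dcsTerm_one]
  | succ j ih =>
    rw [dcsTerm_succ j, Subgroup.commutator_comm]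
    refine commutator_commutator_le_of_rotate ?_ ?_
    · rw [Subgroup.commutator_comm ⊤, ← dcsTerm_succ]
      refine (ih (i + 1)).trans (le_of_eq ?_)
      rw [add_assoc, add_comm 1 j]
    · rw [← add_assoc, dcsTerm_succ]
      exact Subgroup.commutator_mono (ih i) le_rfl

variable (G) in
/-- The descending central series of `G`. -/
def dcs : NSeries G where
  term := dcsTerm G
  antitone_term := dcsTerm_antitone
  commutator_le := dcsTerm_commutator_le

end DCS

/-! ### The Johnson filtration of `Aut(F_n)` -/

/-- `J^s`: the automorphisms of `F` inducing the identity on `F / Γ^{s+1}(F)`. -/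
def johnsonTerm (F : Type*) [Group F] (s : ℕ+) : Subgroup (MulAut F) where
  carrier := {φ | ∀ w : F, (φ w : F ⧸ dcsTerm F (s + 1)) = w}
  one_mem' _ := rfl
  mul_mem' {φ ψ} hφ hψ w := (hφ (ψ w)).trans (hψ w)
  inv_mem' {φ} hφ w := by
    have h := hφ (φ⁻¹ w)
    rw [MulAut.apply_inv_self] at h
    exact h.symm

section Johnson

variable {F : Type*} [Group F]

theorem mem_johnsonTerm {s : ℕ+} {φ : MulAut F} :
    φ ∈ johnsonTerm F s ↔ ∀ w, φ w * w⁻¹ ∈ dcsTerm F (s + 1) := by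
  refine forall_congr' fun w => ?_
  rw [eq_comm, QuotientGroup.eq, (dcsTerm_normal (s + 1)).mem_comm_iff]

theorem mul_inv_mem_dcsTerm {s : ℕ+} {φ : MulAut F} (hφ : φ ∈ johnsonTerm F s) (w : F) :
    φ w * w⁻¹ ∈ dcsTerm F (s + 1) :=
  mem_johnsonTerm.1 hφ w

theorem johnson_apply_dcsTerm {s : ℕ+} {φ : MulAut F} (hφ : φ ∈ johnsonTerm F s) (t : ℕ+) :
    ∀ w ∈ dcsTerm F t, φ w * w⁻¹ ∈ dcsTerm F (s + t) := by
  induction t using PNat.recOn with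
  | one => exact fun w _ => mul_inv_mem_dcsTerm hφ w
  | succ t ih =>
    intro w hw
    rw [← add_assoc]
    set N := dcsTerm F (s + t + 1) with hN
    let q := QuotientGroup.mk' N
    have hq : ∀ x, q x = 1 ↔ x ∈ N := fun x => QuotientGroup.eq_one_iff x
    have hle : dcsTerm F (t + 1) ≤ (q.comp φ.toMonoidHom).eqLocus q := by
      rw [dcsTerm_succ, Subgroup.commutator_le]
      intro a ha b _
      change q (φ ⁅a, b⁆) = q ⁅a, b⁆
      have hu := ih a ha
      have hv := mul_inv_mem_dcsTerm hφ b
      obtain ⟨u, hu'⟩ : ∃ u, u = φ a * a⁻¹ := ⟨_, rfl⟩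
      obtain ⟨v, hv'⟩ : ∃ v, v = φ b * b⁻¹ := ⟨_, rfl⟩
      rw [← hu'] at hu
      rw [← hv'] at hv
      have hφa : φ a = u * a := by rw [hu']; group
      have hφb : φ b = v * b := by rw [hv']; group
      have h1 : ∀ y, Commute (q u) (q y) := by
        intro y
        rw [← commutatorElement_eq_one_iff_commute, ← map_commutatorElement, hq, hN, dcsTerm_succ]
        exact Subgroup.commutator_mem_commutator hu trivial
      have h2 : ∀ y ∈ dcsTerm F t, Commute (q v) (q y) := by
        intro y hy
        rw [← commutatorElement_eq_one_iff_commute, ← map_commutatorElement, hq, hN,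
          add_right_comm]
        exact dcsTerm_commutator_le _ _ (Subgroup.commutator_mem_commutator hv hy)
      have hab : ⁅a, b⁆ ∈ dcsTerm F t := by
        refine dcsTerm_antitone (PNat.lt_add_right t 1).le ?_
        rw [dcsTerm_succ]
        exact Subgroup.commutator_mem_commutator ha trivial
      have e1 : ⁅u * a, v * b⁆ = u * ⁅a, v * b⁆ * u⁻¹ * ⁅u, v * b⁆ :=
        commutatorElement_mul_left_eq_conj_mul u a (v * b)
      have e2 : ⁅a, v * b⁆ = ⁅a, v⁆ * (v * ⁅a, b⁆ * v⁻¹) := by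
        rw [commutatorElement_mul_right_eq_mul_conj]; group
      rw [map_commutatorElement, hφa, hφb, e1]
      simp only [map_mul, map_inv]
      rw [(h1 _).eq, mul_inv_cancel_right, map_commutatorElement q u,
        (commutatorElement_eq_one_iff_commute).2 (h1 (v * b)), mul_one, e2, map_mul,
        map_commutatorElement q a v, (commutatorElement_eq_one_iff_commute).2 (h2 a ha).symm,
        one_mul]
      simp only [map_mul, map_inv]
      rw [(h2 _ hab).eq, mul_inv_cancel_right]
    have h := hle hw
    rw [← hq, map_mul, map_inv, mul_inv_eq_one]
    exact h

theorem johnsonTerm_antitone : Antitone (johnsonTerm F) := fun _ _ hst _ hφ =>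
  mem_johnsonTerm.2 fun w => dcsTerm_antitone (add_le_add_left hst 1) (mul_inv_mem_dcsTerm hφ w)

theorem johnsonTerm_commutator_le (i j : ℕ+) :
    ⁅johnsonTerm F i, johnsonTerm F j⁆ ≤ johnsonTerm F (i + j) := by
  rw [Subgroup.commutator_le]
  intro φ hφ ψ hψ w
  set N := dcsTerm F (i + j + 1) with hN
  have key : ∀ w : F, ((φ (ψ w) : F) : F ⧸ N) = (ψ (φ w) : F) := by
    intro w
    let q := QuotientGroup.mk' N
    have hq : ∀ x, q x = 1 ↔ x ∈ N := fun x => QuotientGroup.eq_one_iff x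
    change q (φ (ψ w)) = q (ψ (φ w))
    have hu := mul_inv_mem_dcsTerm hφ w
    have hv := mul_inv_mem_dcsTerm hψ w
    obtain ⟨u, hu'⟩ : ∃ u, u = φ w * w⁻¹ := ⟨_, rfl⟩
    obtain ⟨v, hv'⟩ : ∃ v, v = ψ w * w⁻¹ := ⟨_, rfl⟩
    rw [← hu'] at hu
    rw [← hv'] at hv
    have hφw : φ w = u * w := by rw [hu']; group
    have hψw : ψ w = v * w := by rw [hv']; group
    have h1 : q (φ v) = q v := by
      rw [← mul_inv_eq_one, ← map_inv, ← map_mul, hq, hN, add_assoc]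
      exact johnson_apply_dcsTerm hφ _ v hv
    have h2 : q (ψ u) = q u := by
      rw [← mul_inv_eq_one, ← map_inv, ← map_mul, hq, hN, add_right_comm, add_comm]
      exact johnson_apply_dcsTerm hψ _ u hu
    have h3 : Commute (q v) (q u) := by
      rw [← commutatorElement_eq_one_iff_commute, ← map_commutatorElement, hq, hN]
      refine dcsTerm_antitone ?_
        (dcsTerm_commutator_le _ _ (Subgroup.commutator_mem_commutator hv hu))
      rw [← PNat.coe_le_coe]
      push_cast
      omega
    rw [hψw, map_mul, map_mul, h1, hφw, map_mul ψ, map_mul q, map_mul q (ψ u), h2, hψw, map_mul,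
      ← mul_assoc, ← mul_assoc, h3.eq]
  have h := key (φ⁻¹ (ψ⁻¹ w))
  rw [MulAut.apply_inv_self, MulAut.apply_inv_self] at h
  exact h

variable (F) in
/-- The Johnson filtration. -/
def johnson : NSeries (MulAut F) where
  term := johnsonTerm F
  antitone_term := johnsonTerm_antitone
  commutator_le := johnsonTerm_commutator_le

end Johnson

/-! ### The upper triangular McCool group -/

section McCool

variable {n : ℕ}

/-- The endomorphism of `F_n` with `x_i ↦ w x_i w⁻¹` and `x_r ↦ x_r` for `r ≠ i`. -/
def conjGenHom (i : Fin n) (w : FreeGroup (Fin n)) : FreeGroup (Fin n) →* FreeGroup (Fin n) :=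
  FreeGroup.lift fun r =>
    if r = i then w * FreeGroup.of r * w⁻¹ else FreeGroup.of r

/-- The automorphism `α_{ij}` of `F_n`: `x_i ↦ x_j x_i x_j⁻¹` and `x_r ↦ x_r` for `r ≠ i`. -/
def alpha (i j : Fin n) (hij : j ≠ i) : MulAut (FreeGroup (Fin n)) :=
  MonoidHom.toMulEquiv (conjGenHom i (FreeGroup.of j)) (conjGenHom i (FreeGroup.of j)⁻¹)
    (by
      ext r
      by_cases h : r = i <;> simp [conjGenHom, h, hij, mul_assoc])
    (by
      ext r
      by_cases h : r = i <;> simp [conjGenHom, h, hij, mul_assoc])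

variable (n) in
/-- The upper triangular McCool group `PΣ_n^+`, generated by the `α_{ij}` with `j < i`. -/
def upperMcCool : Subgroup (MulAut (FreeGroup (Fin n))) :=
  Subgroup.closure {φ | ∃ (i j : Fin n) (h : j < i), φ = alpha i j h.ne}

theorem alpha_mem_johnsonTerm (i j : Fin n) (hij : j ≠ i) :
    alpha i j hij ∈ johnsonTerm (FreeGroup (Fin n)) 1 := by
  let q := QuotientGroup.mk' (dcsTerm (FreeGroup (Fin n)) (1 + 1))
  have h : q.comp (alpha i j hij).toMonoidHom = q := by
    ext r
    by_cases h : r = i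
    · have h1 : alpha i j hij (FreeGroup.of r)
          = ⁅FreeGroup.of j, FreeGroup.of r⁆ * FreeGroup.of r := by
        change conjGenHom i (FreeGroup.of j) (FreeGroup.of r) = _
        simp [conjGenHom, h, commutatorElement_def]
      change q (alpha i j hij (FreeGroup.of r)) = q (FreeGroup.of r)
      rw [h1, map_mul, mul_eq_right]
      refine (QuotientGroup.eq_one_iff _).2 ?_
      rw [dcsTerm_succ]
      exact Subgroup.commutator_mem_commutator trivial trivial
    · change q (conjGenHom i (FreeGroup.of j) (FreeGroup.of r)) = q (FreeGroup.of r)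
      simp [conjGenHom, h]
  exact fun w => DFunLike.congr_fun h w

theorem upperMcCool_le : upperMcCool n ≤ johnsonTerm (FreeGroup (Fin n)) 1 := by
  refine (Subgroup.closure_le _).2 ?_
  rintro φ ⟨i, j, h, rfl⟩
  exact alpha_mem_johnsonTerm i j h.ne

theorem dcs_upperMcCool_le (s : ℕ+) :
    ∀ φ ∈ (dcs (upperMcCool n)).term s,
      (upperMcCool n).subtype φ ∈ (johnson (FreeGroup (Fin n))).term s := by
  suffices h : dcsTerm (upperMcCool n) s
      ≤ (johnsonTerm (FreeGroup (Fin n)) s).comap (upperMcCool n).subtype from fun φ hφ => h hφ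
  induction s using PNat.recOn with
  | one => exact fun φ _ => upperMcCool_le φ.2
  | succ s ih =>
    rw [dcsTerm_succ, Subgroup.commutator_le]
    intro φ hφ ψ _
    rw [Subgroup.mem_comap, map_commutatorElement]
    exact johnsonTerm_commutator_le s 1
      (Subgroup.commutator_mem_commutator (ih hφ) (upperMcCool_le ψ.2))

variable (n) in
/-- The Lie algebra map `⨁_s gr_s^{DCS}(PΣ_n^+) → ⨁_s gr_s^J(IA_n)` induced by the inclusion of
`PΣ_n^+` in `IA_n = J_n^1`. -/
def mcCoolToJohnson :
    (dcs (upperMcCool n)).Gr →ₗ⁅ℤ⁆ (johnson (FreeGroup (Fin n))).Gr :=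
  NSeries.map (upperMcCool n).subtype dcs_upperMcCool_le

end McCool

/-! ### Graded derivations of the free Lie algebra, and the Johnson homomorphism -/

section Derivations

variable (n : ℕ)

/-- The free Lie algebra `L[V_n]` over `ℤ` on the basis `x_1, …, x_n` of `V_n`. -/
abbrev FreeLie : Type := FreeLieAlgebra ℤ (Fin n)

variable {n} in
/-- `IsLieMonomial s x`: `x` is an iterated bracket of `s` generators (in any bracketing). -/
inductive IsLieMonomial : ℕ+ → FreeLie n → Prop
  | of (i : Fin n) : IsLieMonomial 1 (FreeLieAlgebra.of ℤ i)
  | lie {s t : ℕ+} {x y : FreeLie n} :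
      IsLieMonomial s x → IsLieMonomial t y → IsLieMonomial (s + t) ⁅x, y⁆

/-- The homogeneous component `L_s[V_n]`. -/
def freeLieDeg (s : ℕ+) : Submodule ℤ (FreeLie n) := Submodule.span ℤ {x | IsLieMonomial s x}

/-- `Der_s(L[V_n])`: the derivations raising the degree by `s`. -/
def derDeg (s : ℕ+) : Submodule ℤ (LieDerivation ℤ (FreeLie n) (FreeLie n)) where
  carrier := {D | ∀ t, ∀ x ∈ freeLieDeg n t, D x ∈ freeLieDeg n (t + s)}
  add_mem' hD hE t x hx := add_mem (hD t x hx) (hE t x hx)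
  zero_mem' _ _ _ := zero_mem _
  smul_mem' c _ hD t x hx := Submodule.smul_mem _ c (hD t x hx)

/-- `Der(L[V_n]) = ⨁_{s ≥ 1} Der_s(L[V_n])`, the Lie algebra of graded derivations (of positive
degree) of `L[V_n]`, with the commutator bracket `[D, E] = D E - E D`. -/
def gradedDer : LieSubalgebra ℤ (LieDerivation ℤ (FreeLie n) (FreeLie n)) where
  __ := ⨆ s : ℕ+, derDeg n s
  lie_mem' := by
    intro D E hD hE
    change D ∈ ⨆ s : ℕ+, derDeg n s at hD
    change E ∈ ⨆ s : ℕ+, derDeg n s at hE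
    change ⁅D, E⁆ ∈ ⨆ s : ℕ+, derDeg n s
    induction hD using Submodule.iSup_induction' with
    | zero => rw [zero_lie]; exact zero_mem _
    | add D D' _ _ h h' => rw [add_lie]; exact add_mem h h'
    | mem s D hD =>
      induction hE using Submodule.iSup_induction' with
      | zero => rw [lie_zero]; exact zero_mem _
      | add E E' _ _ h h' => rw [lie_add]; exact add_mem h h'
      | mem t E hE =>
        refine Submodule.mem_iSup_of_mem (s + t) fun r x hx => ?_
        rw [LieDerivation.commutator_apply]
        refine sub_mem ?_ ?_
        · have h := hD _ _ (hE r x hx)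
          rwa [add_assoc, add_comm t s] at h
        · have h := hE _ _ (hD r x hx)
          rwa [add_assoc] at h

/-- The canonical Lie algebra map `L[V_n] → gr_*^{DCS}(F_n)`, sending `x_i` to the class of the
`i`-th generator in degree one. -/
def freeLieToGr : FreeLie n →ₗ⁅ℤ⁆ (dcs (FreeGroup (Fin n))).Gr :=
  FreeLieAlgebra.lift ℤ fun i =>
    (dcs (FreeGroup (Fin n))).cls 1 (FreeGroup.of i) trivial

/-- `τ : ⨁_s gr_s^J(IA_n) → Der(L[V_n])` is the map given by the Johnson homomorphisms: for
`φ ∈ J_n^s`, the derivation `τ [φ]` sends `x_i` to the class of `φ(x_i) x_i⁻¹` in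
`Γ^{s+1}(F_n) / Γ^{s+2}(F_n)`, viewed in `L_{s+1}[V_n]` through `freeLieToGr`. -/
def IsJohnsonHom (τ : (johnson (FreeGroup (Fin n))).Gr →ₗ⁅ℤ⁆ gradedDer n) : Prop :=
  ∀ (s : ℕ+) (φ : MulAut (FreeGroup (Fin n)))
    (hφ : φ ∈ (johnson (FreeGroup (Fin n))).term s) (i : Fin n),
    freeLieToGr n
        ((τ ((johnson (FreeGroup (Fin n))).cls s φ hφ)).1 (FreeLieAlgebra.of ℤ i))
      = (dcs (FreeGroup (Fin n))).cls (s + 1) (φ (FreeGroup.of i) * (FreeGroup.of i)⁻¹)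
          (mul_inv_mem_dcsTerm hφ (FreeGroup.of i))

end Derivations

end

/-!
The filtrations in play are compared inside the free associative ring `FreeAssoc` on `x_1, …, x_n`.

*The free Lie ring.* The Lyndon brackets span the free Lie ring (`closure_lyndonBracket_eq_top`: a
non-standard bracket is rewritten by the Jacobi identity into brackets whose larger word is
smaller), and the associative expansion of the bracket of a Lyndon word `w` is `w` plus larger words
(`lyndonBracket_sub_word_mem`). Solving this unitriangular system over `ℤ` yields an additive
retraction `assocRetraction` of the free associative ring onto the free Lie ring. In particular the
free Lie ring embeds in the free associative ring; as this embedding factors through `freeLieToGr`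
by taking leading terms of Magnus expansions (`magnusLie_freeLieToGr`), `freeLieToGr` is injective.
It is surjective because the graded ring of the descending central series is generated in degree
one.

*The Johnson homomorphism.* In the graded ring of the filtration `Γ^s(F) ⋊ J^s` of the holomorph
`F ⋊ Aut(F)`, the bracket of the classes of `φ` and `w` is the class of `φ(w) w⁻¹`. Hence `τ` is an
adjoint representation, and the derivation property and the compatibility with brackets both follow
from the Jacobi identity.

*The additive retraction.* An element `φ` of `PΣ_n^+` sends `x_i` to `w_i x_i w_i⁻¹` with `w_i` in
the subgroup generated by the `x_j` with `j < i`, and `φ` is the product of the automorphisms that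
conjugate only `x_i` by `w_i`. These are the values at `w_i⁻¹` of a homomorphism
`conjAut i : F_n → PΣ_n^+`, so the class of `φ` is determined by the classes of the `w_i`. On the
other hand, `J` sends the class of `φ` to the derivation with `x_i ↦ ⁅w_i, x_i⁆`. The operation
`a ↦ ⁅a, x_i⁆` on the Lie ring generated by the `x_j` with `j < i` has the additive left inverse
`contract i`: expand in the free associative ring, keep the words in which `x_i` occurs as the last
letter and nowhere else, delete this letter, and apply `assocRetraction`. Composing with the maps
of graded rings induced by the `conjAut i` gives a retraction of `J`, which also proves that `J` is
injective.

*No Lie retraction.* Let `r` be a Lie retraction, `ρ = J ∘ r`, and `x, y, z` the first three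
generators. Write `(t; a)` for the derivation with `t ↦ a` vanishing on the other generators, and
`c = ⁅x, y⁆`. Then `(x; ⁅c, x⁆)`, `(y; ⁅c, y⁆)` and `(z; ⁅c, z⁆)` add up to
`⁅(y; ⁅x, y⁆) + (z; ⁅x, z⁆), (x; ⁅y, x⁆) + (z; ⁅y, z⁆)⁆`. The image of this bracket under `ρ` vanishes
on `z`, because its first factor is fixed by `ρ` and acts on the Lie ring generated by `x, y, z` as
the bracket with `x`, which is annihilated by the derivations in the image of `ρ`. As `ρ` fixes
`(z; ⁅c, z⁆) = -⁅(z; ⁅x, z⁆), (z; ⁅y, z⁆)⁆`, there are `u, v` in the Lie ring generated by `x` and `y`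
with `u + v + c = 0`, where `ρ` maps the first two derivations to ones sending `z` to `⁅u, z⁆` and
`⁅v, z⁆`. But these two derivations commute with `(z; ⁅y, z⁆)` and `(z; ⁅x, z⁆)` respectively, and
this forces `u` and `v` to have no component along `c`.
-/

noncomputable section

/-! ### Lexicographic order and Lyndon words -/

section Lyndon

theorem List.append_eq_append_cases {Y : Type*} {u v a b : List Y} (h : u ++ v = a ++ b) :
    (∃ s, v = s ++ b ∧ a = u ++ s) ∨ ∃ s, s ≠ [] ∧ u = a ++ s ∧ b = s ++ v := by
  rcases List.append_eq_append_iff.1 h with ⟨s, h1, h2⟩ | ⟨s, h1, h2⟩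
  · exact Or.inl ⟨s, h2, h1⟩
  · rcases eq_or_ne s [] with rfl | hs
    · exact Or.inl ⟨[], by simpa using h2.symm, by simpa using h1.symm⟩
    · exact Or.inr ⟨s, hs, h1, h2⟩

variable {X : Type*} [LinearOrder X]

theorem List.append_lt_append_iff_left (u : List X) {v w : List X} : u ++ v < u ++ w ↔ v < w := by
  induction u with
  | nil => rfl
  | cons a u ih => rw [List.cons_append, List.cons_append, List.cons_lt_cons_self, ih]

theorem List.lt_append_self (u : List X) {v : List X} (hv : v ≠ []) : u < u ++ v := by
  induction u with
  | nil =>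
    cases v with
    | nil => exact absurd rfl hv
    | cons b v => exact List.nil_lt_cons b v
  | cons a u ih => exact List.cons_lt_cons_self.2 ih

theorem List.le_append_self (u v : List X) : u ≤ u ++ v := by
  rcases eq_or_ne v [] with rfl | hv
  · rw [List.append_nil]
  · exact (List.lt_append_self u hv).le

theorem List.append_lt_append_of_not_prefix {u v : List X} (h : u < v) (hp : ¬ u <+: v)
    (a b : List X) : u ++ a < v ++ b := by
  induction u generalizing v with
  | nil => exact absurd v.nil_prefix hp
  | cons x u ih =>
    cases v with
    | nil => exact absurd h (List.not_lt_nil _)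
    | cons y v =>
      rw [List.cons_append, List.cons_append, List.cons_lt_cons_iff]
      rcases List.cons_lt_cons_iff.1 h with hxy | ⟨rfl, huv⟩
      · exact Or.inl hxy
      · exact Or.inr ⟨rfl, ih huv fun hp' => hp (List.cons_prefix_cons.2 ⟨rfl, hp'⟩)⟩

theorem List.append_lt_append_of_length_le {u v : List X} (h : u < v) (hl : v.length ≤ u.length)
    (a b : List X) : u ++ a < v ++ b :=
  List.append_lt_append_of_not_prefix h (fun hp => h.ne (hp.eq_of_length_le hl)) a b

/-- A Lyndon word: a nonempty word that is strictly smaller than each of its proper nonempty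
suffixes. -/
def IsLyndon (w : List X) : Prop := w ≠ [] ∧ ∀ u v, u ≠ [] → v ≠ [] → w = u ++ v → w < v

theorem isLyndon_singleton (x : X) : IsLyndon [x] := by
  refine ⟨by simp, fun u v hu hv h => ?_⟩
  rw [eq_comm, List.append_eq_singleton_iff] at h
  aesop

theorem IsLyndon.append_lt {u v : List X} (hu : IsLyndon u) (hv : IsLyndon v) (h : u < v) :
    u ++ v < v := by
  by_cases hp : u <+: v
  · obtain ⟨t, rfl⟩ := hp
    rw [List.append_lt_append_iff_left]
    refine hv.2 u t hu.1 ?_ rfl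
    rintro rfl
    simp at h
  · simpa using List.append_lt_append_of_not_prefix h hp v []

theorem IsLyndon.lt_append {u s : List X} (hu : IsLyndon u) {a : List X} (ha : a ≠ [])
    (hs : s ≠ []) (h : u = a ++ s) (v t : List X) : u ++ v < s ++ t := by
  refine List.append_lt_append_of_length_le (hu.2 a s ha hs h) ?_ v t
  rw [h, List.length_append]
  omega

theorem IsLyndon.append {u v : List X} (hu : IsLyndon u) (hv : IsLyndon v) (h : u < v) :
    IsLyndon (u ++ v) := by
  refine ⟨by simp [hu.1], fun a b ha hb hab => ?_⟩
  rcases List.append_eq_append_cases hab with ⟨s, h1, -⟩ | ⟨s, hs, h1, rfl⟩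
  · refine (hu.append_lt hv h).trans_le ?_
    rcases eq_or_ne s [] with rfl | hs
    · rw [h1, List.nil_append]
    · exact (hv.2 s b hs hb h1).le
  · exact hu.lt_append ha hs h1 v v

/-- `IsStd u v`: the word `u ++ v` has the standard factorization `(u, v)`, that is, `v` is the
smallest proper nonempty suffix of `u ++ v`, and `u < v` are Lyndon words. -/
structure IsStd (u v : List X) : Prop where
  left : IsLyndon u
  right : IsLyndon v
  lt : u < v
  le_suffix : ∀ a b, a ≠ [] → b ≠ [] → u ++ v = a ++ b → v ≤ b

theorem IsStd.unique {u v u' v' : List X} (h : IsStd u v) (h' : IsStd u' v')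
    (e : u ++ v = u' ++ v') : u = u' ∧ v = v' := by
  have hv : v = v' := le_antisymm (h.le_suffix _ _ h'.left.1 h'.right.1 e)
    (h'.le_suffix _ _ h.left.1 h.right.1 e.symm)
  subst hv
  exact ⟨List.append_cancel_right e, rfl⟩

/-- Every Lyndon word with at least two letters has a standard factorization: cut off its smallest
proper nonempty suffix. -/
theorem IsLyndon.exists_isStd {w : List X} (hw : IsLyndon w) (h1 : 1 < w.length) :
    ∃ u v, IsStd u v ∧ w = u ++ v := by
  let S : Set (List X) := {v | v ≠ [] ∧ ∃ u, u ≠ [] ∧ w = u ++ v}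
  have hfin : S.Finite := by
    refine (List.finite_toSet w.tails).subset ?_
    rintro v ⟨-, u, -, rfl⟩
    simp
  have hne : S.Nonempty := by
    rcases w with _ | ⟨a, _ | ⟨b, t⟩⟩
    · simp at h1
    · simp at h1
    · exact ⟨b :: t, by simp, [a], by simp, rfl⟩
  obtain ⟨v, ⟨hv, u, hu, rfl⟩, hmin⟩ := hfin.exists_minimalFor id S hne
  have hle : ∀ a b, a ≠ [] → b ≠ [] → u ++ v = a ++ b → v ≤ b := fun a b ha hb h =>
    (le_total v b).elim id fun h' => hmin ⟨hb, a, ha, h⟩ h'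
  have hvL : IsLyndon v := by
    refine ⟨hv, fun a b ha hb h =>
      lt_of_le_of_ne (hle (u ++ a) b (by simp [hu]) hb (by simp [h])) ?_⟩
    rintro rfl
    exact ha (by simpa using h)
  have huL : IsLyndon u := by
    refine ⟨hu, fun a s ha hs h => ?_⟩
    have h2 : u ++ v < s ++ v := hw.2 a (s ++ v) ha (by simp [hs]) (by simp [h])
    by_contra hlt
    have hsu : s < u := lt_of_le_of_ne (not_lt.1 hlt) (by rintro rfl; exact ha (by simpa using h))
    by_cases hp : s <+: u
    · obtain ⟨t, ht⟩ := hp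
      have htne : t ≠ [] := by
        rintro rfl
        simp at ht
        exact hsu.ne ht
      rw [← ht, List.append_assoc, List.append_lt_append_iff_left] at h2
      exact absurd (hle s (t ++ v) hs (by simp [htne]) (by simp [← ht])) (not_le.2 h2)
    · exact absurd (List.append_lt_append_of_not_prefix hsu hp v v) h2.asymm
  exact ⟨u, v, ⟨huL, hvL, (List.le_append_self u v).trans_lt (hw.2 u v hu hv rfl), hle⟩, rfl⟩

/-- If `(a, b)` is the standard factorization of `u` and `v ≤ b`, then `(u, v)` is standard. -/
theorem IsStd.append_of_le {a b v : List X} (h : IsStd a b) (hv : IsLyndon v)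
    (hlt : a ++ b < v) (hle : v ≤ b) : IsStd (a ++ b) v := by
  refine ⟨h.left.append h.right h.lt, hv, hlt, fun c d hc hd hcd => ?_⟩
  rcases List.append_eq_append_cases hcd with ⟨s, h1, -⟩ | ⟨s, hs, h1, rfl⟩
  · rcases eq_or_ne s [] with rfl | hs
    · exact h1.le
    · exact (hv.2 s d hs hd h1).le
  · exact hle.trans ((h.le_suffix c s hc hs h1).trans (List.le_append_self s v))

theorem isStd_singleton {x : X} {v : List X} (hv : IsLyndon v) (h : [x] < v) : IsStd [x] v := by
  refine ⟨isLyndon_singleton x, hv, h, fun c d hc hd hcd => ?_⟩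
  rcases List.append_eq_append_cases hcd with ⟨s, h1, -⟩ | ⟨s, hs, h1, rfl⟩
  · rcases eq_or_ne s [] with rfl | hs
    · exact h1.le
    · exact (hv.2 s d hs hd h1).le
  · rw [eq_comm, List.append_eq_singleton_iff] at h1
    aesop

end Lyndon

/-! ### Lyndon brackets span the free Lie algebra -/

section LyndonBracket

theorem FreeLieAlgebra.lieSpan_range_of (X : Type*) :
    LieSubalgebra.lieSpan ℤ (FreeLieAlgebra ℤ X) (Set.range (FreeLieAlgebra.of ℤ)) = ⊤ := by
  set A := LieSubalgebra.lieSpan ℤ (FreeLieAlgebra ℤ X) (Set.range (FreeLieAlgebra.of ℤ))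
  let F : FreeLieAlgebra ℤ X →ₗ⁅ℤ⁆ A := FreeLieAlgebra.lift ℤ fun x =>
    ⟨FreeLieAlgebra.of ℤ x, LieSubalgebra.subset_lieSpan ⟨x, rfl⟩⟩
  have hF : A.incl.comp F = LieHom.id := by
    ext x
    exact congrArg Subtype.val (FreeLieAlgebra.lift_of_apply (R := ℤ) _ x)
  refine eq_top_iff.2 fun x _ => ?_
  have h := LieHom.congr_fun hF x
  change ((F x : A) : FreeLieAlgebra ℤ X) = x at h
  exact h ▸ (F x).2

variable {X : Type*} [LinearOrder X] {L : Type*} [LieRing L]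

open Classical in
/-- The Lyndon bracketing of a word `w` over the alphabet `X`, evaluated at `f : X → L`: the value
`f x` on the one-letter word `x`, and `⁅u, v⁆` where `(u, v)` is the standard factorization of a
longer Lyndon word. -/
def lyndonBracket (f : X → L) (w : List X) : L :=
  if h : ∃ p : List X × List X, IsStd p.1 p.2 ∧ w = p.1 ++ p.2 then
    ⁅lyndonBracket f h.choose.1, lyndonBracket f h.choose.2⁆
  else match w with
    | [x] => f x
    | _ => 0
termination_by w.length
decreasing_by
  · have h1 := congrArg List.length h.choose_spec.2
    have h2 := List.length_pos_iff.2 h.choose_spec.1.right.1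
    rw [List.length_append] at h1
    omega
  · have h1 := congrArg List.length h.choose_spec.2
    have h2 := List.length_pos_iff.2 h.choose_spec.1.left.1
    rw [List.length_append] at h1
    omega

/-- The bracketing of a word does not depend on the choice of its standard factorization, which is
unique. -/
theorem lyndonBracket_append (f : X → L) {u v : List X} (h : IsStd u v) :
    lyndonBracket f (u ++ v) = ⁅lyndonBracket f u, lyndonBracket f v⁆ := by
  have h' : ∃ p : List X × List X, IsStd p.1 p.2 ∧ u ++ v = p.1 ++ p.2 := ⟨(u, v), h, rfl⟩
  obtain ⟨h1, h2⟩ := h.unique h'.choose_spec.1 h'.choose_spec.2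
  rw [lyndonBracket, dif_pos h', ← h1, ← h2]

theorem lyndonBracket_singleton (f : X → L) (x : X) : lyndonBracket f [x] = f x := by
  rw [lyndonBracket, dif_neg]
  rintro ⟨⟨u, v⟩, h, h'⟩
  rw [eq_comm, List.append_eq_singleton_iff] at h'
  have h1 := h.left.1
  have h2 := h.right.1
  aesop

/-- The span of the Lyndon brackets of the Lyndon words of length `N` in the interval `[a, b)`. -/
def lyndonSpan (f : X → L) (N : ℕ) (a b : List X) : AddSubgroup L :=
  AddSubgroup.closure (lyndonBracket f '' {w | IsLyndon w ∧ w.length = N ∧ a ≤ w ∧ w < b})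

theorem lyndonSpan_mono (f : X → L) (N : ℕ) {a a' b b' : List X} (ha : a' ≤ a) (hb : b ≤ b') :
    lyndonSpan f N a b ≤ lyndonSpan f N a' b' :=
  AddSubgroup.closure_mono <| Set.image_mono fun _ hw =>
    ⟨hw.1, hw.2.1, ha.trans hw.2.2.1, hw.2.2.2.trans_le hb⟩

/-- The bracket of two Lyndon brackets `u < v` is a combination of Lyndon brackets of words `w` with
`u ++ v ≤ w < v`. If `(u, v)` is not standard, then `u` has a standard factorization `(a, b)` with
`b < v`; the Jacobi identity leads to shorter brackets, and to pairs whose larger word is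
smaller than `v`. -/
theorem lie_lyndonBracket_mem [Finite X] (f : X → L) (N : ℕ) :
    ∀ v u : List X, IsLyndon u → IsLyndon v → u < v → u.length + v.length = N →
      ⁅lyndonBracket f u, lyndonBracket f v⁆ ∈ lyndonSpan f N (u ++ v) v := by
  induction N using Nat.strong_induction_on with | _ N ihN
  have hfin : Finite {l : List X | l.length < N} := List.finite_length_lt X N
  have wf : WellFounded (fun a b : {l : List X | l.length < N} => a.1 < b.1) :=
    haveI : IsTrans {l : List X | l.length < N} (fun a b => a.1 < b.1) := ⟨fun _ _ _ => lt_trans⟩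
    haveI : Std.Irrefl (fun a b : {l : List X | l.length < N} => a.1 < b.1) :=
      ⟨fun _ => lt_irrefl _⟩
    Finite.wellFounded_of_trans_of_irrefl _
  -- An inner induction on `v`: words of length less than `N` form a finite set, on which
  -- the order is well-founded.
  suffices key : ∀ v : {l : List X | l.length < N}, ∀ u : List X, IsLyndon u → IsLyndon v.1 →
      u < v.1 → u.length + v.1.length = N →
      ⁅lyndonBracket f u, lyndonBracket f v.1⁆ ∈ lyndonSpan f N (u ++ v.1) v.1 by
    intro v u hu hv huv hN
    have := List.length_pos_iff.2 hu.1
    exact key ⟨v, show v.length < N by omega⟩ u hu hv huv hN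
  intro v
  induction v using wf.induction with | _ v ihv
  obtain ⟨v, hvN⟩ := v
  simp only at ihv ⊢
  intro u hu hv huv hN
  have std : IsStd u v → ⁅lyndonBracket f u, lyndonBracket f v⁆ ∈ lyndonSpan f N (u ++ v) v := by
    intro h
    refine AddSubgroup.subset_closure ⟨u ++ v, ⟨hu.append hv huv, by simp [hN], le_rfl,
      hu.append_lt hv huv⟩, lyndonBracket_append f h⟩
  rcases Nat.lt_or_ge 1 u.length with h1 | h1
  swap
  · have := List.length_pos_iff.2 hu.1
    obtain ⟨x, rfl⟩ := List.length_eq_one_iff.1 (le_antisymm h1 this)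
    exact std (isStd_singleton hv huv)
  obtain ⟨a, b, hab, rfl⟩ := hu.exists_isStd h1
  rcases le_or_gt v b with hvb | hbv
  · exact std (hab.append_of_le hv huv hvb)
  have ha := List.length_pos_iff.2 hab.left.1
  have hb := List.length_pos_iff.2 hab.right.1
  have hvl := List.length_pos_iff.2 hv.1
  rw [List.length_append] at hN
  have hav : a < v := (List.le_append_self a b).trans_lt huv
  have hbvlt := hab.right.append_lt hv hbv
  have hublt : a ++ b ++ v < b := by
    simpa using hu.lt_append hab.left.1 hab.right.1 rfl v []
  rw [lyndonBracket_append f hab, lie_lie, sub_eq_add_neg, add_comm, ← lie_skew, neg_neg]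
  refine add_mem ?_ ?_
  · -- the terms `⁅⁅a, v⁆, b⁆`
    have h := ihN (a.length + v.length) (by omega) v a hab.left hv hav rfl
    generalize ⁅lyndonBracket f a, lyndonBracket f v⁆ = y at h ⊢
    induction h using AddSubgroup.closure_induction with
    | zero => rw [zero_lie]; exact zero_mem _
    | add x y _ _ hx hy => rw [add_lie]; exact add_mem hx hy
    | neg x _ hx => rw [neg_lie]; exact neg_mem hx
    | mem x hx =>
      obtain ⟨w, ⟨hw, hwl, haw, hwv⟩, rfl⟩ := hx
      have huw : a ++ b ++ v ≤ w := by
        refine le_trans (le_of_lt ?_) haw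
        rw [List.append_assoc, List.append_lt_append_iff_left]
        exact hbvlt
      rcases lt_trichotomy w b with hwb | rfl | hbw
      · exact lyndonSpan_mono f N (huw.trans (List.le_append_self w b)) hbv.le
          (ihv ⟨b, show b.length < N by omega⟩ hbv w hw hab.right hwb
            (show w.length + b.length = N by omega))
      · rw [lie_self]; exact zero_mem _
      · rw [← lie_skew]
        exact neg_mem (lyndonSpan_mono f N (hublt.le.trans (List.le_append_self b w)) hwv.le
          (ihv ⟨w, show w.length < N by omega⟩ hwv b hab.right hw hbw
            (show b.length + w.length = N by omega)))
  · -- the terms `⁅a, ⁅b, v⁆⁆`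
    have h := ihN (b.length + v.length) (by omega) v b hab.right hv hbv rfl
    generalize ⁅lyndonBracket f b, lyndonBracket f v⁆ = y at h ⊢
    induction h using AddSubgroup.closure_induction with
    | zero => rw [lie_zero]; exact zero_mem _
    | add x y _ _ hx hy => rw [lie_add]; exact add_mem hx hy
    | neg x _ hx => rw [lie_neg]; exact neg_mem hx
    | mem x hx =>
      obtain ⟨w, ⟨hw, hwl, hbw, hwv⟩, rfl⟩ := hx
      have haw : a < w := hab.lt.trans_le ((List.le_append_self b v).trans hbw)
      refine lyndonSpan_mono f N ?_ hwv.le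
        (ihv ⟨w, show w.length < N by omega⟩ hwv a hab.left hw haw
          (show a.length + w.length = N by omega))
      rw [List.append_assoc]
      rcases hbw.eq_or_lt with rfl | hbw
      · exact le_rfl
      · exact ((List.append_lt_append_iff_left a).2 hbw).le

/-- The Lyndon brackets of the letters of a finite alphabet span the free Lie algebra. -/
theorem closure_lyndonBracket_eq_top [Finite X] :
    AddSubgroup.closure (lyndonBracket (FreeLieAlgebra.of ℤ : X → FreeLieAlgebra ℤ X) ''
      {w | IsLyndon w}) = ⊤ := by
  set f : X → FreeLieAlgebra ℤ X := FreeLieAlgebra.of ℤ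
  set S := AddSubgroup.closure (lyndonBracket f '' {w | IsLyndon w}) with hS
  have hle : ∀ N a b, lyndonSpan f N a b ≤ S := fun N a b =>
    AddSubgroup.closure_mono (Set.image_mono fun w hw => hw.1)
  have hlie : ∀ {x y}, x ∈ S → y ∈ S → ⁅x, y⁆ ∈ S := by
    intro x y hx hy
    induction hx using AddSubgroup.closure_induction with
    | zero => rw [zero_lie]; exact zero_mem _
    | add x y _ _ hx hy => rw [add_lie]; exact add_mem hx hy
    | neg x _ hx => rw [neg_lie]; exact neg_mem hx
    | mem x hx =>
    induction hy using AddSubgroup.closure_induction with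
    | zero => rw [lie_zero]; exact zero_mem _
    | add x y _ _ hx hy => rw [lie_add]; exact add_mem hx hy
    | neg x _ hx => rw [lie_neg]; exact neg_mem hx
    | mem y hy =>
      obtain ⟨u, hu, rfl⟩ := hx
      obtain ⟨v, hv, rfl⟩ := hy
      rcases lt_trichotomy u v with h | rfl | h
      · exact hle _ _ _ (lie_lyndonBracket_mem f _ v u hu hv h rfl)
      · rw [lie_self]; exact zero_mem _
      · rw [← lie_skew]
        exact neg_mem (hle _ _ _ (lie_lyndonBracket_mem f _ u v hv hu h rfl))
  let A : LieSubalgebra ℤ (FreeLieAlgebra ℤ X) :=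
    { __ := AddSubgroup.toIntSubmodule S
      lie_mem' := fun hx hy => hlie hx hy }
  have hA : LieSubalgebra.lieSpan ℤ _ (Set.range f) ≤ A := by
    rw [LieSubalgebra.lieSpan_le]
    rintro _ ⟨x, rfl⟩
    exact AddSubgroup.subset_closure ⟨[x], isLyndon_singleton x, lyndonBracket_singleton f x⟩
  rw [FreeLieAlgebra.lieSpan_range_of] at hA
  exact (AddSubgroup.eq_top_iff' S).2 fun x => hA (LieSubalgebra.mem_top x)

end LyndonBracket

/-! ### The free Lie algebra is a direct summand of the free associative algebra -/

section Retraction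

attribute [local instance] LieRing.ofAssociativeRing

variable {X : Type*}

variable (X) in
/-- The free associative ring on `X`, with its basis of words. -/
abbrev FreeAssoc : Type _ := MonoidAlgebra ℤ (FreeMonoid X)

/-- A word as an element of the free associative ring. -/
def word (w : List X) : FreeAssoc X := MonoidAlgebra.single (FreeMonoid.ofList w) 1

theorem word_append (u v : List X) : word (u ++ v) = word u * word v := by
  simp [word, MonoidAlgebra.single_mul_single]

/-- The canonical map from the free Lie algebra to the free associative ring. -/
def freeLieToAssoc : FreeLieAlgebra ℤ X →ₗ⁅ℤ⁆ FreeAssoc X :=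
  FreeLieAlgebra.lift ℤ fun x => word [x]

theorem freeLieToAssoc_of (x : X) : freeLieToAssoc (FreeLieAlgebra.of ℤ x) = word [x] :=
  FreeLieAlgebra.lift_of_apply _ x

/-- The subgroup spanned by a set of words. -/
def wordSpan (S : Set (List X)) : AddSubgroup (FreeAssoc X) := AddSubgroup.closure (word '' S)

theorem wordSpan_mono {S S' : Set (List X)} (h : S ⊆ S') : wordSpan S ≤ wordSpan S' :=
  AddSubgroup.closure_mono (Set.image_mono h)

theorem word_mem_wordSpan {S : Set (List X)} {w : List X} (h : w ∈ S) : word w ∈ wordSpan S :=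
  AddSubgroup.subset_closure ⟨w, h, rfl⟩

theorem mul_mem_wordSpan {S S' U : Set (List X)} (h : ∀ u ∈ S, ∀ v ∈ S', u ++ v ∈ U)
    {x y : FreeAssoc X} (hx : x ∈ wordSpan S) (hy : y ∈ wordSpan S') : x * y ∈ wordSpan U := by
  induction hx using AddSubgroup.closure_induction with
  | zero => rw [zero_mul]; exact zero_mem _
  | add x y _ _ hx hy => rw [add_mul]; exact add_mem hx hy
  | neg x _ hx => rw [neg_mul]; exact neg_mem hx
  | mem x hx =>
  induction hy using AddSubgroup.closure_induction with
  | zero => rw [mul_zero]; exact zero_mem _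
  | add x y _ _ hx hy => rw [mul_add]; exact add_mem hx hy
  | neg x _ hx => rw [mul_neg]; exact neg_mem hx
  | mem y hy =>
    obtain ⟨u, hu, rfl⟩ := hx
    obtain ⟨v, hv, rfl⟩ := hy
    rw [← word_append]
    exact word_mem_wordSpan (h u hu v hv)

theorem of_coeff_ne_zero_of_mem_wordSpan {S : Set (List X)} {x : FreeAssoc X}
    (hx : x ∈ wordSpan S) {m : FreeMonoid X} (hm : x.coeff m ≠ 0) : m.toList ∈ S := by
  by_contra hS
  refine hm ?_
  clear hm
  induction hx using AddSubgroup.closure_induction with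
  | zero => simp
  | add x y _ _ hx hy => simp [hx, hy]
  | neg x _ hx => simp [hx]
  | mem x hx =>
    obtain ⟨u, hu, rfl⟩ := hx
    rw [word, MonoidAlgebra.coeff_single]
    refine Finsupp.single_eq_of_ne ?_
    rintro rfl
    exact hS hu

variable [LinearOrder X]

theorem map_lyndonBracket {L L' : Type*} [LieRing L] [LieRing L'] (F : L →ₗ⁅ℤ⁆ L') (f : X → L)
    {w : List X} (hw : IsLyndon w) :
    F (lyndonBracket f w) = lyndonBracket (F ∘ f) w := by
  induction h : w.length using Nat.strong_induction_on generalizing w with | _ N ih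
  subst h
  have h0 := List.length_pos_iff.2 hw.1
  rcases Nat.lt_or_ge 1 w.length with h1 | h1
  · obtain ⟨u, v, huv, rfl⟩ := hw.exists_isStd h1
    have hu := List.length_pos_iff.2 huv.left.1
    have hv := List.length_pos_iff.2 huv.right.1
    rw [lyndonBracket_append f huv, lyndonBracket_append _ huv, LieHom.map_lie,
      ih u.length (by simp; omega) huv.left rfl, ih v.length (by simp; omega) huv.right rfl]
  · obtain ⟨x, rfl⟩ := List.length_eq_one_iff.1 (le_antisymm h1 h0)
    rw [lyndonBracket_singleton, lyndonBracket_singleton, Function.comp_apply]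

/-- The words of the same length as `w` that are larger than `w`. -/
def largerWords (w : List X) : Set (List X) := {w' | w'.length = w.length ∧ w < w'}

/-- The associative expansion of a Lyndon bracket is unitriangular. -/
theorem lyndonBracket_sub_word_mem {w : List X} (hw : IsLyndon w) :
    lyndonBracket (fun x : X => word [x]) w - word w ∈ wordSpan (largerWords w) := by
  induction h : w.length using Nat.strong_induction_on generalizing w with | _ N ih
  subst h
  have h0 := List.length_pos_iff.2 hw.1
  rcases Nat.lt_or_ge 1 w.length with h1 | h1
  swap
  · obtain ⟨x, rfl⟩ := List.length_eq_one_iff.1 (le_antisymm h1 h0)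
    rw [lyndonBracket_singleton, sub_self]
    exact zero_mem _
  obtain ⟨u, v, huv, rfl⟩ := hw.exists_isStd h1
  have hul := List.length_pos_iff.2 huv.left.1
  have hvl := List.length_pos_iff.2 huv.right.1
  have hu := ih u.length (by simp; omega) huv.left rfl
  have hv := ih v.length (by simp; omega) huv.right rfl
  have hge : ∀ {w : List X} {p : FreeAssoc X}, p - word w ∈ wordSpan (largerWords w) →
      p ∈ wordSpan {w' | w'.length = w.length ∧ w ≤ w'} := by
    intro w p hp
    have h2 := add_mem (wordSpan_mono (S' := {w' | w'.length = w.length ∧ w ≤ w'})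
      (fun w' hw' => ⟨hw'.1, hw'.2.le⟩) hp)
      (word_mem_wordSpan (S := {w' | w'.length = w.length ∧ w ≤ w'}) ⟨rfl, le_rfl⟩)
    rwa [sub_add_cancel] at h2
  rw [lyndonBracket_append _ huv, LieRing.of_associative_ring_bracket, word_append]
  set p := lyndonBracket (fun x : X => word [x]) u
  set q := lyndonBracket (fun x : X => word [x]) v
  have e : p * q - q * p - word u * word v
      = (p - word u) * q + word u * (q - word v) - q * p := by noncomm_ring
  rw [e]
  refine sub_mem (add_mem ?_ ?_) ?_
  · refine mul_mem_wordSpan ?_ hu (hge hv)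
    rintro a ⟨ha, hua⟩ b ⟨hb, -⟩
    exact ⟨by simp [ha, hb], List.append_lt_append_of_length_le hua ha.le v b⟩
  · refine mul_mem_wordSpan (S := {u}) ?_ (word_mem_wordSpan rfl) hv
    rintro a rfl b ⟨hb, hvb⟩
    exact ⟨by simp [hb], (List.append_lt_append_iff_left a).2 hvb⟩
  · refine mul_mem_wordSpan ?_ (hge hv) (hge hu)
    rintro a ⟨ha, hva⟩ b ⟨hb, -⟩
    exact ⟨by simp [ha, hb, add_comm],
      (huv.left.append_lt huv.right huv.lt).trans_le (hva.trans (List.le_append_self a b))⟩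

theorem ncard_largerWords_lt [Finite X] {w w' : List X} (h : w' ∈ largerWords w) :
    (largerWords w').ncard < (largerWords w).ncard := by
  refine Set.ncard_lt_ncard ?_ ((List.finite_length_eq X w.length).subset fun _ h => h.1)
  refine ⟨fun v hv => ⟨hv.1.trans h.1, h.2.trans hv.2⟩, fun hle => ?_⟩
  exact lt_irrefl _ (hle h).2

open Classical in
/-- The values on words of a retraction of the free associative ring onto the free Lie algebra,
found by solving the unitriangular system given by `lyndonBracket_sub_word_mem`; words that are
not Lyndon words are sent to `0`. -/
def retractionWord [Finite X] (w : List X) : FreeLieAlgebra ℤ X :=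
  if IsLyndon w then
    lyndonBracket (FreeLieAlgebra.of ℤ) w -
      (lyndonBracket (fun x : X => word [x]) w - word w).coeff.sum fun m c =>
        if _h : m.toList ∈ largerWords w then c • retractionWord m.toList else 0
  else 0
termination_by (largerWords w).ncard
decreasing_by exact ncard_largerWords_lt _h

variable [Finite X]

/-- An additive retraction of the free associative ring onto the free Lie algebra. -/
def assocRetraction : FreeAssoc X →+ FreeLieAlgebra ℤ X :=
  ((Finsupp.linearCombination ℤ fun m : FreeMonoid X => retractionWord m.toList).comp
    (MonoidAlgebra.coeffLinearEquiv ℤ).toLinearMap).toAddMonoidHom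

theorem assocRetraction_apply (x : FreeAssoc X) :
    assocRetraction x = x.coeff.sum fun m c => c • retractionWord m.toList := rfl

theorem assocRetraction_lyndonBracket {w : List X} (hw : IsLyndon w) :
    assocRetraction (lyndonBracket (fun x : X => word [x]) w)
      = lyndonBracket (FreeLieAlgebra.of ℤ) w := by
  have h1 := lyndonBracket_sub_word_mem hw
  have h2 : assocRetraction (word w) = retractionWord w := by
    rw [assocRetraction_apply, word, MonoidAlgebra.coeff_single, Finsupp.sum_single_index] <;> simp
  rw [← sub_add_cancel (lyndonBracket _ w) (word w), map_add, h2, retractionWord, if_pos hw,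
    assocRetraction_apply]
  rw [add_sub_left_comm, add_eq_left, sub_eq_zero]
  refine Finsupp.sum_congr fun m hm => ?_
  rw [dif_pos (of_coeff_ne_zero_of_mem_wordSpan h1 (Finsupp.mem_support_iff.1 hm))]

theorem assocRetraction_freeLieToAssoc (x : FreeLieAlgebra ℤ X) :
    assocRetraction (freeLieToAssoc x) = x := by
  have hx : x ∈ AddSubgroup.closure (lyndonBracket (FreeLieAlgebra.of ℤ : X → FreeLieAlgebra ℤ X) ''
      {w | IsLyndon w}) :=
    closure_lyndonBracket_eq_top (X := X) ▸ AddSubgroup.mem_top x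
  induction hx using AddSubgroup.closure_induction with
  | zero => simp
  | add x y _ _ hx hy => rw [map_add, map_add, hx, hy]
  | neg x _ hx => rw [map_neg, map_neg, hx]
  | mem x hx =>
    obtain ⟨w, hw, rfl⟩ := hx
    rw [map_lyndonBracket _ _ hw]
    have : (freeLieToAssoc ∘ FreeLieAlgebra.of ℤ : X → FreeAssoc X) = fun x => word [x] :=
      funext freeLieToAssoc_of
    rw [this, assocRetraction_lyndonBracket hw]

theorem freeLieToAssoc_injective : Function.Injective (freeLieToAssoc (X := X)) :=
  Function.LeftInverse.injective assocRetraction_freeLieToAssoc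

end Retraction

/-! ### The Magnus expansion -/

section PowerSeriesUnits

open PowerSeries

attribute [local instance] LieRing.ofAssociativeRing

variable {R : Type*} [Ring R]

theorem PowerSeries.coeff_mul_of_X_pow_dvd {i j : ℕ} {p q : R⟦X⟧} (hp : X ^ i ∣ p)
    (hq : X ^ j ∣ q) : coeff (i + j) (p * q) = coeff i p * coeff j q := by
  obtain ⟨a, rfl⟩ := hp
  obtain ⟨b, rfl⟩ := hq
  have e : X ^ i * a * (X ^ j * b) = X ^ (i + j) * (a * b) := by
    rw [pow_add, mul_assoc, ← mul_assoc a, (commute_X_pow a j).eq]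
    simp only [mul_assoc]
  rw [e]
  simp [coeff_X_pow_mul']

theorem PowerSeries.X_pow_add_dvd_mul {i j : ℕ} {p q : R⟦X⟧} (hp : X ^ i ∣ p) (hq : X ^ j ∣ q) :
    X ^ (i + j) ∣ p * q := by
  obtain ⟨a, rfl⟩ := hp
  obtain ⟨b, rfl⟩ := hq
  refine ⟨a * b, ?_⟩
  rw [pow_add, mul_assoc, ← mul_assoc a, (commute_X_pow a j).eq]
  simp only [mul_assoc]

variable (R) in
/-- The filtration of the units of `R⟦X⟧` by the subgroups `1 + X ^ s R⟦X⟧`. -/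
def unitSeries : NSeries R⟦X⟧ˣ where
  term s :=
    { carrier := {u | X ^ (s : ℕ) ∣ (u : R⟦X⟧) - 1}
      one_mem' := by simp
      mul_mem' := by
        intro u v hu hv
        have e : ((u * v : R⟦X⟧ˣ) : R⟦X⟧) - 1 = ((u : R⟦X⟧) - 1) * v + ((v : R⟦X⟧) - 1) := by
          push_cast; noncomm_ring
        change X ^ (s : ℕ) ∣ ((u * v : R⟦X⟧ˣ) : R⟦X⟧) - 1
        rw [e]
        exact dvd_add (Dvd.dvd.mul_right hu _) hv
      inv_mem' := by
        intro u hu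
        have e : ((u⁻¹ : R⟦X⟧ˣ) : R⟦X⟧) - 1 = -(((u : R⟦X⟧) - 1) * (u⁻¹ : R⟦X⟧ˣ)) := by
          rw [sub_mul, one_mul, Units.mul_inv, neg_sub]
        change X ^ (s : ℕ) ∣ ((u⁻¹ : R⟦X⟧ˣ) : R⟦X⟧) - 1
        rw [e]
        exact (Dvd.dvd.mul_right hu _).neg_right }
  antitone_term := fun _ _ hst _ hu => (pow_dvd_pow X (PNat.coe_le_coe _ _ |>.2 hst)).trans hu
  commutator_le := by
    intro i j
    rw [Subgroup.commutator_le]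
    intro u hu v hv
    change X ^ ((i + j : ℕ+) : ℕ) ∣ ((⁅u, v⁆ : R⟦X⟧ˣ) : R⟦X⟧) - 1
    have e : ((⁅u, v⁆ : R⟦X⟧ˣ) : R⟦X⟧) - 1
        = (((u : R⟦X⟧) - 1) * ((v : R⟦X⟧) - 1) - ((v : R⟦X⟧) - 1) * ((u : R⟦X⟧) - 1))
          * ((u⁻¹ * v⁻¹ : R⟦X⟧ˣ) : R⟦X⟧) := by
      have e1 : ((u : R⟦X⟧) - 1) * ((v : R⟦X⟧) - 1) - ((v : R⟦X⟧) - 1) * ((u : R⟦X⟧) - 1)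
          = ((u * v : R⟦X⟧ˣ) : R⟦X⟧) - ((v * u : R⟦X⟧ˣ) : R⟦X⟧) := by
        push_cast; noncomm_ring
      rw [e1, sub_mul, ← Units.val_mul, ← Units.val_mul, commutatorElement_def]
      congr 2
      · group
      · rw [mul_assoc, mul_inv_cancel_left, mul_inv_cancel, Units.val_one]
    rw [e, PNat.add_coe]
    refine Dvd.dvd.mul_right (dvd_sub (X_pow_add_dvd_mul hu hv) ?_) _
    rw [add_comm]
    exact X_pow_add_dvd_mul hv hu

theorem mem_unitSeries {s : ℕ+} {u : R⟦X⟧ˣ} :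
    u ∈ (unitSeries R).term s ↔ X ^ (s : ℕ) ∣ (u : R⟦X⟧) - 1 := Iff.rfl

theorem coeff_pnat_one (s : ℕ+) : coeff (s : ℕ) (1 : R⟦X⟧) = 0 := by
  rw [coeff_one, if_neg s.ne_zero]

theorem coeff_eq_coeff_sub_one (s : ℕ+) (p : R⟦X⟧) :
    coeff (s : ℕ) p = coeff (s : ℕ) (p - 1) := by
  rw [map_sub, coeff_pnat_one, sub_zero]

theorem coeff_mul_unitSeries {s : ℕ+} {u v : R⟦X⟧ˣ} (hu : u ∈ (unitSeries R).term s)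
    (hv : v ∈ (unitSeries R).term s) :
    coeff (s : ℕ) ((u * v : R⟦X⟧ˣ) : R⟦X⟧)
      = coeff (s : ℕ) (u : R⟦X⟧) + coeff (s : ℕ) (v : R⟦X⟧) := by
  have e : ((u * v : R⟦X⟧ˣ) : R⟦X⟧)
      = u + v - 1 + ((u : R⟦X⟧) - 1) * ((v : R⟦X⟧) - 1) := by
    push_cast; noncomm_ring
  have h : coeff (s : ℕ) (((u : R⟦X⟧) - 1) * ((v : R⟦X⟧) - 1)) = 0 :=
    X_pow_dvd_iff.1 (X_pow_add_dvd_mul hu hv) _ (by have := s.pos; omega)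
  rw [e, map_add, h, add_zero, map_sub, coeff_pnat_one, sub_zero, map_add]

/-- The leading coefficient `1 + a X ^ s + ⋯ ↦ a` on each graded piece of `unitSeries R`. -/
def leadingCoeffAdd : (unitSeries R).Gr →+ R :=
  (unitSeries R).liftGr fun s => MonoidHom.toAdditiveLeft <|
    QuotientGroup.lift _
      (MonoidHom.mk' (fun u : (unitSeries R).term s =>
          Multiplicative.ofAdd (coeff (s : ℕ) ((u : R⟦X⟧ˣ) : R⟦X⟧)))
        fun u v => congrArg Multiplicative.ofAdd (coeff_mul_unitSeries u.2 v.2)) <| by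
      rintro ⟨u, hu⟩ hu'
      rw [Subgroup.mem_subgroupOf] at hu'
      refine congrArg Multiplicative.ofAdd (?_ : coeff (s : ℕ) (u : R⟦X⟧) = 0)
      rw [coeff_eq_coeff_sub_one]
      exact X_pow_dvd_iff.1 hu' _ (by simp)

theorem leadingCoeffAdd_cls {s : ℕ+} {u : R⟦X⟧ˣ} (hu : u ∈ (unitSeries R).term s) :
    leadingCoeffAdd ((unitSeries R).cls s u hu) = coeff (s : ℕ) (u : R⟦X⟧) := by
  exact (unitSeries R).liftGr_ofPiece _ s ((unitSeries R).pieceMk s ⟨u, hu⟩)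

variable (R) in
/-- The leading coefficient as a Lie algebra map. -/
def leadingCoeff : (unitSeries R).Gr →ₗ⁅ℤ⁆ R where
  toLinearMap := leadingCoeffAdd.toIntLinearMap
  map_lie' := by
    intro a b
    change leadingCoeffAdd ⁅a, b⁆ = ⁅leadingCoeffAdd a, leadingCoeffAdd b⁆
    induction a using NSeries.gr_induction with
    | zero => simp
    | add a a' h h' => rw [add_lie, map_add, h, h', map_add, add_lie]
    | cls i u hu =>
      induction b using NSeries.gr_induction with
      | zero => simp
      | add b b' h h' => rw [lie_add, map_add, h, h', map_add, lie_add]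
      | cls j v hv =>
        rw [NSeries.lie_cls, leadingCoeffAdd_cls, leadingCoeffAdd_cls, leadingCoeffAdd_cls,
          LieRing.of_associative_ring_bracket]
        have hk := (unitSeries R).comm_mem hu hv
        set k := ⁅u, v⁆ with hk'
        have e : ((k : R⟦X⟧) - 1) * ((v * u : R⟦X⟧ˣ) : R⟦X⟧)
            = ((u : R⟦X⟧) - 1) * ((v : R⟦X⟧) - 1) - ((v : R⟦X⟧) - 1) * ((u : R⟦X⟧) - 1) := by
          have e1 : k * (v * u) = u * v := by rw [hk', commutatorElement_def]; group
          rw [sub_mul, ← Units.val_mul, e1]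
          push_cast; noncomm_ring
        have e0 : coeff 0 ((v * u : R⟦X⟧ˣ) : R⟦X⟧) = 1 := by
          have hvu := mul_mem ((unitSeries R).antitone_term one_le hv)
            ((unitSeries R).antitone_term one_le hu)
          have h := X_pow_dvd_iff.1 (mem_unitSeries.1 hvu) 0 (by simp)
          rw [map_sub, sub_eq_zero] at h
          rw [h]
          simp
        have h1 := congrArg (coeff ((i + j : ℕ+) : ℕ)) e
        have h2 := coeff_mul_of_X_pow_dvd (q := ((v * u : R⟦X⟧ˣ) : R⟦X⟧)) (j := 0)
          (mem_unitSeries.1 hk) (by simp)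
        rw [add_zero, e0, mul_one, ← coeff_eq_coeff_sub_one] at h2
        rw [← h2, h1, map_sub, PNat.add_coe, coeff_mul_of_X_pow_dvd hu hv, add_comm (i : ℕ),
          coeff_mul_of_X_pow_dvd hv hu]
        simp only [← coeff_eq_coeff_sub_one]

theorem leadingCoeff_cls {s : ℕ+} {u : R⟦X⟧ˣ} (hu : u ∈ (unitSeries R).term s) :
    leadingCoeff R ((unitSeries R).cls s u hu) = coeff (s : ℕ) (u : R⟦X⟧) :=
  leadingCoeffAdd_cls hu

end PowerSeriesUnits

section Magnus

attribute [local instance] LieRing.ofAssociativeRing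

/-- The descending central series is contained in every filtration that starts with the whole
group. -/
theorem dcs_map_mem {G H : Type*} [Group G] [Group H] (Δ : NSeries H) (f : G →* H)
    (hf : ∀ x, f x ∈ Δ.term 1) (s : ℕ+) : ∀ x ∈ (dcs G).term s, f x ∈ Δ.term s := by
  suffices h : dcsTerm G s ≤ (Δ.term s).comap f from fun x hx => h hx
  induction s using PNat.recOn with
  | one => exact fun x _ => hf x
  | succ s ih =>
    rw [dcsTerm_succ, Subgroup.commutator_le]
    intro x hx y _
    rw [Subgroup.mem_comap, map_commutatorElement]
    exact Δ.comm_mem (ih hx) (hf y)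

variable {X : Type*}

/-- The unit `1 + x t` of the ring of power series in `t` over the free associative ring. -/
def magnusUnit (x : X) : (PowerSeries (FreeAssoc X))ˣ :=
  have h : PowerSeries.constantCoeff (1 + PowerSeries.C (word [x]) * PowerSeries.X)
      = ((1 : (FreeAssoc X)ˣ) : FreeAssoc X) := by simp
  ⟨1 + PowerSeries.C (word [x]) * PowerSeries.X,
    PowerSeries.invOfUnit (1 + PowerSeries.C (word [x]) * PowerSeries.X) 1,
    PowerSeries.mul_invOfUnit _ _ h, PowerSeries.invOfUnit_mul _ _ h⟩

variable (X) in
/-- The Magnus expansion `x ↦ 1 + x t`. Marking the degree by the central variable `t` replaces the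
completion of the free associative ring. -/
def magnus : FreeGroup X →* (PowerSeries (FreeAssoc X))ˣ := FreeGroup.lift magnusUnit

theorem magnus_mem (w : FreeGroup X) : magnus X w ∈ (unitSeries (FreeAssoc X)).term 1 := by
  suffices h : (magnus X).range ≤ (unitSeries (FreeAssoc X)).term 1 from h ⟨w, rfl⟩
  refine FreeGroup.range_lift_le ?_
  rintro _ ⟨x, rfl⟩
  rw [SetLike.mem_coe, mem_unitSeries, PNat.one_coe, pow_one]
  refine ⟨PowerSeries.C (word [x]), ?_⟩
  rw [(PowerSeries.commute_X _).eq.symm]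
  exact add_sub_cancel_left _ _

variable (X) in
/-- The Lie algebra map from the graded ring of the descending central series of the free group to
the free associative ring, given by the leading terms of Magnus expansions. -/
def magnusLie : (dcs (FreeGroup X)).Gr →ₗ⁅ℤ⁆ FreeAssoc X :=
  (leadingCoeff (FreeAssoc X)).comp
    (NSeries.map (magnus X) (dcs_map_mem (unitSeries (FreeAssoc X)) (magnus X) magnus_mem))

variable {n : ℕ}

theorem mem_dcs_one {G : Type*} [Group G] (x : G) : x ∈ (dcs G).term 1 := trivial

theorem freeLieToGr_of (i : Fin n) : freeLieToGr n (FreeLieAlgebra.of ℤ i)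
    = (dcs (FreeGroup (Fin n))).cls 1 (FreeGroup.of i) (mem_dcs_one _) :=
  FreeLieAlgebra.lift_of_apply _ i

theorem NSeries.map_cls {G H : Type*} [Group G] [Group H] {Γ : NSeries G} {Δ : NSeries H}
    (f : G →* H) (hf : ∀ s, ∀ x ∈ Γ.term s, f x ∈ Δ.term s) {s : ℕ+} {x : G}
    (hx : x ∈ Γ.term s) : NSeries.map f hf (Γ.cls s x hx) = Δ.cls s (f x) (hf s x hx) :=
  NSeries.mapAdd_cls f hf hx

theorem magnusLie_freeLieToGr (a : FreeLie n) :
    magnusLie (Fin n) (freeLieToGr n a) = freeLieToAssoc a := by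
  suffices h : (magnusLie (Fin n)).comp (freeLieToGr n) = freeLieToAssoc from LieHom.congr_fun h a
  ext i : 1
  change leadingCoeff (FreeAssoc (Fin n)) (NSeries.map (magnus (Fin n)) _
    (freeLieToGr n (FreeLieAlgebra.of ℤ i))) = freeLieToAssoc (FreeLieAlgebra.of ℤ i)
  rw [freeLieToGr_of, freeLieToAssoc_of, NSeries.map_cls, leadingCoeff_cls, magnus,
    FreeGroup.lift_apply_of]
  simp [magnusUnit, PowerSeries.coeff_one]

theorem freeLieToGr_injective : Function.Injective (freeLieToGr n) := by
  intro a b h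
  refine freeLieToAssoc_injective ?_
  rw [← magnusLie_freeLieToGr, ← magnusLie_freeLieToGr, h]

theorem lie_mem_freeLieDeg {s t : ℕ+} {a b : FreeLie n} (ha : a ∈ freeLieDeg n s)
    (hb : b ∈ freeLieDeg n t) : ⁅a, b⁆ ∈ freeLieDeg n (s + t) := by
  induction ha using Submodule.span_induction with
  | zero => rw [zero_lie]; exact zero_mem _
  | add a a' _ _ h h' => rw [add_lie]; exact add_mem h h'
  | smul c a _ h => rw [smul_lie]; exact Submodule.smul_mem _ c h
  | mem a ha =>
    induction hb using Submodule.span_induction with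
    | zero => rw [lie_zero]; exact zero_mem _
    | add a a' _ _ h h' => rw [lie_add]; exact add_mem h h'
    | smul c a _ h => rw [lie_smul]; exact Submodule.smul_mem _ c h
    | mem b hb => exact Submodule.subset_span (ha.lie hb)

theorem of_mem_freeLieDeg (i : Fin n) : FreeLieAlgebra.of ℤ i ∈ freeLieDeg n 1 :=
  Submodule.subset_span (IsLieMonomial.of i)

/-- The classes in degree `s` are the images of the elements of `L_s[V_n]`: the graded ring of the
descending central series is generated in degree one. -/
theorem exists_freeLieToGr_eq_cls (s : ℕ+) (x : FreeGroup (Fin n))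
    (hx : x ∈ (dcs (FreeGroup (Fin n))).term s) :
    ∃ a ∈ freeLieDeg n s, freeLieToGr n a = (dcs (FreeGroup (Fin n))).cls s x hx := by
  set Γ := dcs (FreeGroup (Fin n)) with hΓ
  let S : ℕ+ → Subgroup (FreeGroup (Fin n)) := fun s =>
    { carrier := {x | ∃ hx : x ∈ Γ.term s, ∃ a ∈ freeLieDeg n s, freeLieToGr n a = Γ.cls s x hx}
      one_mem' := ⟨one_mem _, 0, zero_mem _, by rw [map_zero, Γ.cls_one]⟩
      mul_mem' := by
        rintro x y ⟨hx, a, ha, hax⟩ ⟨hy, b, hb, hby⟩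
        exact ⟨mul_mem hx hy, a + b, add_mem ha hb, by rw [map_add, hax, hby, Γ.cls_mul]⟩
      inv_mem' := by
        rintro x ⟨hx, a, ha, hax⟩
        refine ⟨inv_mem hx, -a, neg_mem ha, ?_⟩
        rw [map_neg, neg_eq_iff_add_eq_zero, hax, ← Γ.cls_mul hx (inv_mem hx),
          Γ.cls_congr rfl (mul_inv_cancel x) _ (one_mem _), Γ.cls_one] }
  suffices key : ∀ s, Γ.term s ≤ S s from (key s hx).2
  have h1 : ∀ x, x ∈ S 1 := by
    have h : Subgroup.closure (Set.range FreeGroup.of) ≤ S 1 := by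
      rw [Subgroup.closure_le]
      rintro _ ⟨i, rfl⟩
      exact ⟨mem_dcs_one _, _, of_mem_freeLieDeg i, freeLieToGr_of i⟩
    rw [FreeGroup.closure_range_of] at h
    exact fun x => h (Subgroup.mem_top x)
  intro s
  induction s using PNat.recOn with
  | one => exact fun x _ => h1 x
  | succ s ih =>
    change dcsTerm _ (s + 1) ≤ _
    rw [dcsTerm_succ, Subgroup.commutator_le]
    intro x hx y _
    obtain ⟨hx, a, ha, hax⟩ := ih hx
    obtain ⟨hy, b, hb, hby⟩ := h1 y
    exact ⟨Γ.comm_mem hx hy, ⁅a, b⁆, lie_mem_freeLieDeg ha hb, by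
      rw [LieHom.map_lie, hax, hby, Γ.lie_cls]⟩

theorem freeLieToGr_surjective : Function.Surjective (freeLieToGr n) := by
  intro x
  induction x using NSeries.gr_induction with
  | zero => exact ⟨0, map_zero _⟩
  | add x y hx hy =>
    obtain ⟨a, rfl⟩ := hx
    obtain ⟨b, rfl⟩ := hy
    exact ⟨a + b, map_add _ a b⟩
  | cls s x hx =>
    obtain ⟨a, -, h⟩ := exists_freeLieToGr_eq_cls s x hx
    exact ⟨a, h⟩

theorem freeLieToGr_bijective : Function.Bijective (freeLieToGr n) :=
  ⟨freeLieToGr_injective, freeLieToGr_surjective⟩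

end Magnus

/-! ### The Johnson homomorphism -/

section Holomorph

theorem NSeries.map_injective {G H : Type*} [Group G] [Group H] {Γ : NSeries G} {Δ : NSeries H}
    (f : G →* H) (hf : ∀ s, ∀ x ∈ Γ.term s, f x ∈ Δ.term s)
    (h : ∀ s, ∀ x ∈ Γ.term s, f x ∈ Δ.term (s + 1) → x ∈ Γ.term (s + 1)) :
    Function.Injective (NSeries.map f hf) := by
  have h1 : Function.Injective (DirectSum.map fun s =>
      (MonoidHom.toAdditive (NSeries.mapQuot f hf s) : Γ.Piece s →+ Δ.Piece s)) := by
    rw [DirectSum.map_injective]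
    intro s
    rw [injective_iff_map_eq_zero]
    intro x hx
    obtain ⟨⟨y, hy⟩, rfl⟩ := QuotientGroup.mk_surjective (Additive.toMul x)
    have hx' : (QuotientGroup.mk (⟨f y, hf s y hy⟩ : Δ.term s) : Δ.QuotPiece s) = 1 := hx
    rw [QuotientGroup.eq_one_iff, Subgroup.mem_subgroupOf] at hx'
    have h2 : (QuotientGroup.mk (⟨y, hy⟩ : Γ.term s) : Γ.QuotPiece s) = 1 := by
      rw [QuotientGroup.eq_one_iff, Subgroup.mem_subgroupOf]
      exact h s y hy hx'
    exact h2
  have h2 : ∀ x, NSeries.map f hf x = DirectSum.map (fun s =>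
      (MonoidHom.toAdditive (NSeries.mapQuot f hf s) : Γ.Piece s →+ Δ.Piece s)) x := by
    intro x
    induction x using NSeries.gr_induction with
    | zero => rw [map_zero]; exact (map_zero (DirectSum.map _)).symm
    | add x y hx hy => rw [map_add, hx, hy]; exact (map_add (DirectSum.map _) x y).symm
    | cls s x hx =>
      rw [NSeries.map_cls]
      exact (DirectSum.map_of (fun s =>
        (MonoidHom.toAdditive (NSeries.mapQuot f hf s) : Γ.Piece s →+ Δ.Piece s)) s
          (Γ.pieceMk s ⟨x, hx⟩)).symm
  intro x y hxy
  rw [h2, h2] at hxy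
  exact h1 hxy

/-- The class of an element of `term s` vanishes if and only if the element lies in
`term (s + 1)`. -/
theorem NSeries.cls_eq_zero_iff {G : Type*} [Group G] {Γ : NSeries G} {s : ℕ+} {x : G}
    (hx : x ∈ Γ.term s) : Γ.cls s x hx = 0 ↔ x ∈ Γ.term (s + 1) := by
  have h1 : Γ.cls s x hx = 0 ↔ Γ.pieceMk s ⟨x, hx⟩ = 0 :=
    (injective_iff_map_eq_zero' (Γ.ofPiece s)).1 (DirectSum.of_injective (β := Γ.Piece) s) _
  have h2 : Γ.pieceMk s ⟨x, hx⟩ = 0 ↔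
      (QuotientGroup.mk (⟨x, hx⟩ : Γ.term s) : Γ.QuotPiece s) = 1 := Iff.rfl
  rw [h1, h2, QuotientGroup.eq_one_iff, Subgroup.mem_subgroupOf]

variable (F : Type*) [Group F]

/-- The holomorph `F ⋊ Aut(F)`. -/
abbrev Holomorph : Type _ := F ⋊[MonoidHom.id (MulAut F)] MulAut F

variable {F}

theorem apply_mem_dcsTerm (φ : MulAut F) {s : ℕ+} {x : F} (hx : x ∈ dcsTerm F s) :
    φ x ∈ dcsTerm F s :=
  dcs_map_mem (dcs F) φ.toMonoidHom (fun _ => trivial) s x hx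

variable (F) in
/-- The filtration of the holomorph `F ⋊ Aut(F)` by the subgroups `Γ^s(F) ⋊ J^s`. In its graded
ring, the bracket of the classes of `φ ∈ J^s` and `w ∈ Γ^t(F)` is the class of `φ(w) w⁻¹`, so that
the Johnson homomorphism becomes an adjoint representation. -/
def holomorphSeries : NSeries (Holomorph F) where
  term s :=
    { carrier := {g | g.left ∈ dcsTerm F s ∧ g.right ∈ johnsonTerm F s}
      one_mem' := ⟨one_mem _, one_mem _⟩
      mul_mem' := fun {g h} hg hh =>
        ⟨mul_mem hg.1 (apply_mem_dcsTerm g.right hh.1), mul_mem hg.2 hh.2⟩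
      inv_mem' := fun {g} hg =>
        ⟨apply_mem_dcsTerm g.right⁻¹ (inv_mem hg.1), inv_mem hg.2⟩ }
  antitone_term := fun _ _ hst _ hg => ⟨dcsTerm_antitone hst hg.1, johnsonTerm_antitone hst hg.2⟩
  commutator_le := by
    intro i j
    rw [Subgroup.commutator_le]
    rintro g ⟨hw, hφ⟩ h ⟨hv, hψ⟩
    have hk2 : (⁅g, h⁆).right ∈ johnsonTerm F (i + j) :=
      johnsonTerm_commutator_le i j (Subgroup.commutator_mem_commutator hφ hψ)
    refine ⟨?_, hk2⟩
    have e : ⁅g, h⁆ * (h * g) = g * h := by rw [commutatorElement_def]; group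
    have e' := congrArg SemidirectProduct.left e
    let q := QuotientGroup.mk' (dcsTerm F (i + j))
    have hq : ∀ x, q x = 1 ↔ x ∈ dcsTerm F (i + j) := fun x => QuotientGroup.eq_one_iff x
    have heq : ∀ x y, x * y⁻¹ ∈ dcsTerm F (i + j) → q x = q y := by
      intro x y hxy
      rwa [← hq, map_mul, map_inv, mul_inv_eq_one] at hxy
    have h1 : q (g.right h.left) = q h.left := heq _ _ (johnson_apply_dcsTerm hφ j _ hv)
    have h2 : q (h.right g.left) = q g.left :=
      heq _ _ (by rw [add_comm]; exact johnson_apply_dcsTerm hψ i _ hw)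
    have h3 : ∀ y, q ((⁅g, h⁆).right y) = q y := fun y => heq _ _
      (dcsTerm_antitone (PNat.lt_add_right _ 1).le (mul_inv_mem_dcsTerm hk2 y))
    have h4 : Commute (q g.left) (q h.left) := by
      rw [← commutatorElement_eq_one_iff_commute, ← map_commutatorElement, hq]
      exact dcsTerm_commutator_le _ _ (Subgroup.commutator_mem_commutator hw hv)
    rw [← hq]
    simp only [SemidirectProduct.mul_left, MonoidHom.id_apply] at e'
    have e2 := congrArg q e'
    rw [map_mul, map_mul q g.left, h1, h3, map_mul, h2, h4.eq, mul_eq_right] at e2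
    exact e2

theorem inl_mem_holomorphSeries (s : ℕ+) (w : F) (hw : w ∈ (dcs F).term s) :
    (SemidirectProduct.inl w : Holomorph F) ∈ (holomorphSeries F).term s :=
  ⟨hw, one_mem _⟩

theorem inr_mem_holomorphSeries (s : ℕ+) (φ : MulAut F) (hφ : φ ∈ (johnson F).term s) :
    (SemidirectProduct.inr φ : Holomorph F) ∈ (holomorphSeries F).term s :=
  ⟨one_mem _, hφ⟩

/-- The map of graded rings induced by the inclusion of `F` in its holomorph. -/
def grInl : (dcs F).Gr →ₗ⁅ℤ⁆ (holomorphSeries F).Gr :=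
  NSeries.map SemidirectProduct.inl inl_mem_holomorphSeries

/-- The map of graded rings induced by the inclusion of `Aut(F)` in the holomorph of `F`. -/
def grInr : (johnson F).Gr →ₗ⁅ℤ⁆ (holomorphSeries F).Gr :=
  NSeries.map SemidirectProduct.inr inr_mem_holomorphSeries

theorem grInl_injective : Function.Injective (grInl (F := F)) :=
  NSeries.map_injective _ _ fun _ _ _ h => h.1

theorem johnson_apply_mem {s t : ℕ+} {φ : MulAut F} {w : F} (hφ : φ ∈ (johnson F).term s)
    (hw : w ∈ (dcs F).term t) : φ w * w⁻¹ ∈ (dcs F).term (s + t) :=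
  johnson_apply_dcsTerm hφ t w hw

theorem lie_grInr_grInl_cls {s t : ℕ+} {φ : MulAut F} {w : F} (hφ : φ ∈ (johnson F).term s)
    (hw : w ∈ (dcs F).term t) :
    ⁅grInr ((johnson F).cls s φ hφ), grInl ((dcs F).cls t w hw)⁆
      = grInl ((dcs F).cls (s + t) (φ w * w⁻¹) (johnson_apply_mem hφ hw)) := by
  rw [grInr, grInl, NSeries.map_cls, NSeries.map_cls, NSeries.map_cls, NSeries.lie_cls]
  refine NSeries.cls_congr _ rfl ?_ _ _
  have h := SemidirectProduct.inl_aut (φ := MonoidHom.id (MulAut F)) φ w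
  rw [MonoidHom.id_apply, map_inv] at h
  rw [map_mul, h, map_inv, commutatorElement_def]

theorem exists_grInl_eq_lie (a : (johnson F).Gr) (x : (dcs F).Gr) :
    ∃ y, grInl y = ⁅grInr a, grInl x⁆ := by
  induction a using NSeries.gr_induction with
  | zero => exact ⟨0, by simp⟩
  | add a a' h h' =>
    obtain ⟨y, hy⟩ := h
    obtain ⟨y', hy'⟩ := h'
    exact ⟨y + y', by rw [map_add, map_add, add_lie, hy, hy']⟩
  | cls s φ hφ =>
    induction x using NSeries.gr_induction with
    | zero => exact ⟨0, by simp⟩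
    | add a a' h h' =>
      obtain ⟨y, hy⟩ := h
      obtain ⟨y', hy'⟩ := h'
      exact ⟨y + y', by rw [map_add, map_add, lie_add, hy, hy']⟩
    | cls t w hw => exact ⟨_, (lie_grInr_grInl_cls hφ hw).symm⟩

end Holomorph

section JohnsonHom

variable {n : ℕ}

/-- The free Lie algebra inside the graded ring of the holomorph of the free group. -/
def freeLieToHolomorph : FreeLie n →ₗ⁅ℤ⁆ (holomorphSeries (FreeGroup (Fin n))).Gr :=
  grInl.comp (freeLieToGr n)

theorem freeLieToHolomorph_injective : Function.Injective (freeLieToHolomorph (n := n)) :=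
  grInl_injective.comp freeLieToGr_injective

theorem exists_freeLieToHolomorph_eq_lie (a : (johnson (FreeGroup (Fin n))).Gr) (x : FreeLie n) :
    ∃ y, freeLieToHolomorph y = ⁅grInr a, freeLieToHolomorph x⁆ := by
  obtain ⟨y, hy⟩ := exists_grInl_eq_lie a (freeLieToGr n x)
  obtain ⟨z, rfl⟩ := freeLieToGr_surjective y
  exact ⟨z, hy⟩

/-- The function underlying `johnsonDer`. -/
def johnsonDerFun (a : (johnson (FreeGroup (Fin n))).Gr) (x : FreeLie n) : FreeLie n :=
  (exists_freeLieToHolomorph_eq_lie a x).choose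

theorem freeLieToHolomorph_johnsonDerFun (a : (johnson (FreeGroup (Fin n))).Gr) (x : FreeLie n) :
    freeLieToHolomorph (johnsonDerFun a x) = ⁅grInr a, freeLieToHolomorph x⁆ :=
  (exists_freeLieToHolomorph_eq_lie a x).choose_spec

/-- The derivation of the free Lie algebra given by the adjoint action of an element of the graded
ring of the Johnson filtration inside the graded ring of the holomorph. -/
def johnsonDer (a : (johnson (FreeGroup (Fin n))).Gr) :
    LieDerivation ℤ (FreeLie n) (FreeLie n) where
  toLinearMap := (AddMonoidHom.mk' (johnsonDerFun a) <| by
    intro x y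
    refine freeLieToHolomorph_injective ?_
    rw [map_add]
    simp only [freeLieToHolomorph_johnsonDerFun]
    rw [map_add, lie_add]).toIntLinearMap
  leibniz' := by
    intro x y
    refine freeLieToHolomorph_injective ?_
    change freeLieToHolomorph (johnsonDerFun a ⁅x, y⁆)
      = freeLieToHolomorph (⁅x, johnsonDerFun a y⁆ - ⁅y, johnsonDerFun a x⁆)
    rw [map_sub, LieHom.map_lie, LieHom.map_lie]
    simp only [freeLieToHolomorph_johnsonDerFun]
    rw [LieHom.map_lie, leibniz_lie, ← lie_skew (freeLieToHolomorph y)]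
    abel

theorem freeLieToHolomorph_johnsonDer (a : (johnson (FreeGroup (Fin n))).Gr) (x : FreeLie n) :
    freeLieToHolomorph (johnsonDer a x) = ⁅grInr a, freeLieToHolomorph x⁆ :=
  freeLieToHolomorph_johnsonDerFun a x

theorem freeLieToGr_johnsonDer {s t : ℕ+} {φ : MulAut (FreeGroup (Fin n))}
    {w : FreeGroup (Fin n)} (hφ : φ ∈ (johnson (FreeGroup (Fin n))).term s)
    (hw : w ∈ (dcs (FreeGroup (Fin n))).term t) {x : FreeLie n}
    (hx : freeLieToGr n x = (dcs (FreeGroup (Fin n))).cls t w hw) :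
    freeLieToGr n (johnsonDer ((johnson (FreeGroup (Fin n))).cls s φ hφ) x)
      = (dcs (FreeGroup (Fin n))).cls (s + t) (φ w * w⁻¹) (johnson_apply_mem hφ hw) := by
  refine grInl_injective ?_
  rw [← lie_grInr_grInl_cls hφ hw, ← hx]
  exact freeLieToHolomorph_johnsonDer _ x

/-- A derivation that raises the degree of the generators by `s` raises all degrees by `s`. -/
theorem mem_derDeg {s : ℕ+} {D : LieDerivation ℤ (FreeLie n) (FreeLie n)}
    (h : ∀ i, D (FreeLieAlgebra.of ℤ i) ∈ freeLieDeg n (1 + s)) : D ∈ derDeg n s := by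
  intro t x hx
  induction hx using Submodule.span_induction with
  | zero => rw [map_zero]; exact zero_mem _
  | add a a' _ _ h h' => rw [map_add]; exact add_mem h h'
  | smul c a _ h => rw [map_smul]; exact Submodule.smul_mem _ c h
  | mem x hx =>
    induction hx with
    | of i => exact h i
    | @lie t r x y hx hy ihx ihy =>
      rw [LieDerivation.apply_lie_eq_add]
      refine add_mem ?_ ?_
      · have := lie_mem_freeLieDeg (Submodule.subset_span hx) ihy
        rwa [← add_assoc] at this
      · have := lie_mem_freeLieDeg ihx (Submodule.subset_span hy)
        rwa [add_right_comm] at this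

theorem derDeg_le_gradedDer {s : ℕ+} {D : LieDerivation ℤ (FreeLie n) (FreeLie n)}
    (h : D ∈ derDeg n s) : D ∈ gradedDer n :=
  (le_iSup (derDeg n) s) h

theorem johnsonDer_mem_derDeg {s : ℕ+} {φ : MulAut (FreeGroup (Fin n))}
    (hφ : φ ∈ (johnson (FreeGroup (Fin n))).term s) :
    johnsonDer ((johnson (FreeGroup (Fin n))).cls s φ hφ) ∈ derDeg n s := by
  refine mem_derDeg fun i => ?_
  have h := freeLieToGr_johnsonDer hφ (mem_dcs_one (FreeGroup.of i)) (freeLieToGr_of i)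
  obtain ⟨b, hb, hb'⟩ := exists_freeLieToGr_eq_cls (s + 1) (φ (FreeGroup.of i) * (FreeGroup.of i)⁻¹)
    (johnson_apply_mem hφ (mem_dcs_one _))
  rw [← hb'] at h
  rw [freeLieToGr_injective h, add_comm]
  exact hb

theorem johnsonDer_add (a b : (johnson (FreeGroup (Fin n))).Gr) :
    johnsonDer (a + b) = johnsonDer a + johnsonDer b := by
  ext x
  refine freeLieToHolomorph_injective ?_
  rw [LieDerivation.add_apply, map_add, freeLieToHolomorph_johnsonDer,
    freeLieToHolomorph_johnsonDer, freeLieToHolomorph_johnsonDer, map_add, add_lie]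

theorem johnsonDer_lie (a b : (johnson (FreeGroup (Fin n))).Gr) :
    johnsonDer ⁅a, b⁆ = ⁅johnsonDer a, johnsonDer b⁆ := by
  ext x
  refine freeLieToHolomorph_injective ?_
  rw [LieDerivation.commutator_apply, map_sub]
  simp only [freeLieToHolomorph_johnsonDer]
  rw [LieHom.map_lie, lie_lie]

theorem johnsonDer_mem (a : (johnson (FreeGroup (Fin n))).Gr) : johnsonDer a ∈ gradedDer n := by
  induction a using NSeries.gr_induction with
  | zero =>
    have h := johnsonDer_add (0 : (johnson (FreeGroup (Fin n))).Gr) 0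
    rw [add_zero, left_eq_add] at h
    rw [h]
    exact zero_mem _
  | add a b ha hb => rw [johnsonDer_add]; exact add_mem ha hb
  | cls s φ hφ => exact derDeg_le_gradedDer (johnsonDer_mem_derDeg hφ)

variable (n) in
/-- The Johnson homomorphism on the graded ring of the Johnson filtration. -/
def johnsonHom : (johnson (FreeGroup (Fin n))).Gr →ₗ⁅ℤ⁆ gradedDer n where
  toLinearMap := (AddMonoidHom.mk' (fun a => (⟨johnsonDer a, johnsonDer_mem a⟩ : gradedDer n))
    fun a b => Subtype.ext (johnsonDer_add a b)).toIntLinearMap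
  map_lie' := fun {a b} => Subtype.ext (johnsonDer_lie a b)

theorem johnsonHom_isJohnsonHom : IsJohnsonHom n (johnsonHom n) := fun _ _ hφ i =>
  freeLieToGr_johnsonDer hφ (mem_dcs_one (FreeGroup.of i)) (freeLieToGr_of i)

end JohnsonHom

/-! ### The structure of the upper triangular McCool group -/

section Kill

variable {n : ℕ}

/-- The endomorphism of `F_n` that fixes `x_j` for `j < i` and kills the other generators. The
subgroup generated by the `x_j` with `j < i` consists of the `w` with `killGroup i w = w`. -/
def killGroup (i : Fin n) : FreeGroup (Fin n) →* FreeGroup (Fin n) :=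
  FreeGroup.lift fun j => if j < i then FreeGroup.of j else 1

/-- The endomorphism of the free Lie algebra that fixes `x_j` for `j < i` and kills the other
generators. The Lie subalgebra generated by the `x_j` with `j < i` consists of the `a` with
`killLie i a = a`. -/
def killLie (i : Fin n) : FreeLie n →ₗ⁅ℤ⁆ FreeLie n :=
  FreeLieAlgebra.lift ℤ fun j => if j < i then FreeLieAlgebra.of ℤ j else 0

theorem killGroup_of (i j : Fin n) :
    killGroup i (FreeGroup.of j) = if j < i then FreeGroup.of j else 1 :=
  FreeGroup.lift_apply_of

theorem killLie_of (i j : Fin n) :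
    killLie i (FreeLieAlgebra.of ℤ j) = if j < i then FreeLieAlgebra.of ℤ j else 0 :=
  FreeLieAlgebra.lift_of_apply _ j

theorem killGroup_killGroup {i j : Fin n} (h : j ≤ i) (w : FreeGroup (Fin n)) :
    killGroup i (killGroup j w) = killGroup j w := by
  suffices (killGroup i).comp (killGroup j) = killGroup j from DFunLike.congr_fun this w
  ext r
  rw [MonoidHom.comp_apply, killGroup_of]
  split_ifs with hr
  · rw [killGroup_of, if_pos (hr.trans_le h)]
  · rw [map_one]

theorem killLie_killLie {i j : Fin n} (h : j ≤ i) (a : FreeLie n) :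
    killLie i (killLie j a) = killLie j a := by
  suffices (killLie i).comp (killLie j) = killLie j from LieHom.congr_fun this a
  ext r : 1
  change killLie i (killLie j (FreeLieAlgebra.of ℤ r)) = killLie j (FreeLieAlgebra.of ℤ r)
  rw [killLie_of]
  split_ifs with hr
  · rw [killLie_of, if_pos (hr.trans_le h)]
  · rw [map_zero]

theorem killGroup_mem (i : Fin n) (s : ℕ+) : ∀ x ∈ (dcs (FreeGroup (Fin n))).term s,
    killGroup i x ∈ (dcs (FreeGroup (Fin n))).term s :=
  dcs_map_mem _ (killGroup i) (fun _ => mem_dcs_one _) s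

theorem freeLieToGr_killLie (i : Fin n) (a : FreeLie n) :
    freeLieToGr n (killLie i a)
      = NSeries.map (killGroup i) (killGroup_mem i) (freeLieToGr n a) := by
  suffices (freeLieToGr n).comp (killLie i)
      = (NSeries.map (killGroup i) (killGroup_mem i)).comp (freeLieToGr n) from
    LieHom.congr_fun this a
  ext j : 1
  change freeLieToGr n (killLie i (FreeLieAlgebra.of ℤ j))
    = NSeries.map (killGroup i) (killGroup_mem i) (freeLieToGr n (FreeLieAlgebra.of ℤ j))
  rw [freeLieToGr_of, NSeries.map_cls, killLie_of]
  split_ifs with h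
  · rw [freeLieToGr_of]
    exact NSeries.cls_congr _ rfl (by rw [killGroup_of, if_pos h]) _ _
  · rw [map_zero, NSeries.cls_congr _ rfl (y := 1) (by rw [killGroup_of, if_neg h]) _ (one_mem _),
      NSeries.cls_one]

/-- The element of the free Lie algebra corresponding to a class in the graded ring of the
descending central series of `F_n`. -/
def grToFreeLie (x : (dcs (FreeGroup (Fin n))).Gr) : FreeLie n := (freeLieToGr_surjective x).choose

theorem freeLieToGr_grToFreeLie (x : (dcs (FreeGroup (Fin n))).Gr) :
    freeLieToGr n (grToFreeLie x) = x :=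
  (freeLieToGr_surjective x).choose_spec

theorem killLie_grToFreeLie_cls {i : Fin n} {s : ℕ+} {w : FreeGroup (Fin n)}
    (hw : w ∈ (dcs (FreeGroup (Fin n))).term s) (hi : killGroup i w = w) :
    killLie i (grToFreeLie ((dcs (FreeGroup (Fin n))).cls s w hw))
      = grToFreeLie ((dcs (FreeGroup (Fin n))).cls s w hw) := by
  refine freeLieToGr_injective ?_
  rw [freeLieToGr_killLie, freeLieToGr_grToFreeLie, NSeries.map_cls]
  exact NSeries.cls_congr _ rfl hi _ _

end Kill

section Contract

attribute [local instance] LieRing.ofAssociativeRing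

variable {n : ℕ}

/-- The embedding of a ring as the upper left corner of the `2 × 2` matrices. -/
def cornerHom (R : Type*) [Ring R] : R →ₗ⁅ℤ⁆ Matrix (Fin 2) (Fin 2) R where
  toLinearMap := (Matrix.singleAddMonoidHom 0 0).toIntLinearMap
  map_lie' := by
    intro a b
    change Matrix.single 0 0 ⁅a, b⁆ = ⁅Matrix.single 0 0 a, Matrix.single 0 0 b⁆
    rw [LieRing.of_associative_ring_bracket, LieRing.of_associative_ring_bracket,
      Matrix.single_mul_single_same, Matrix.single_mul_single_same]
    exact map_sub (Matrix.singleAddMonoidHom 0 0) _ _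

theorem cornerHom_apply {R : Type*} [Ring R] (a : R) : cornerHom R a = Matrix.single 0 0 a := rfl

/-- The representation of the free Lie algebra by `2 × 2` matrices over the free associative ring
that sends `x_i` to the elementary matrix `E₀₁`, and `x_j` to `x_j E₀₀` for `j ≠ i`. -/
def cornerRep (i : Fin n) : FreeLie n →ₗ⁅ℤ⁆ Matrix (Fin 2) (Fin 2) (FreeAssoc (Fin n)) :=
  FreeLieAlgebra.lift ℤ fun j => if j = i then Matrix.single 0 1 1 else cornerHom _ (word [j])

theorem cornerRep_of (i j : Fin n) : cornerRep i (FreeLieAlgebra.of ℤ j)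
    = if j = i then Matrix.single 0 1 1 else cornerHom _ (word [j]) :=
  FreeLieAlgebra.lift_of_apply _ j

theorem cornerRep_killLie (i : Fin n) (a : FreeLie n) :
    cornerRep i (killLie i a) = cornerHom _ (freeLieToAssoc (killLie i a)) := by
  suffices (cornerRep i).comp (killLie i)
      = ((cornerHom _).comp freeLieToAssoc).comp (killLie i) from LieHom.congr_fun this a
  ext j : 1
  change cornerRep i (killLie i (FreeLieAlgebra.of ℤ j))
    = cornerHom _ (freeLieToAssoc (killLie i (FreeLieAlgebra.of ℤ j)))
  rw [killLie_of]
  split_ifs with h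
  · rw [cornerRep_of, if_neg h.ne, freeLieToAssoc_of]
  · rw [map_zero, map_zero, map_zero]

/-- An additive left inverse of `a ↦ ⁅a, x_i⁆` on the Lie subalgebra generated by the `x_j` with
`j < i`: such an `a` acts by `a E₀₀`, so that `⁅a, x_i⁆` acts by `a E₀₁`. -/
def contract (i : Fin n) : FreeLie n →+ FreeLie n :=
  assocRetraction.comp (AddMonoidHom.mk' (fun a => cornerRep i a 0 1) fun a b => by
    rw [map_add, Matrix.add_apply])

theorem contract_lie {i : Fin n} {a : FreeLie n} (ha : killLie i a = a) :
    contract i ⁅a, FreeLieAlgebra.of ℤ i⁆ = a := by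
  change assocRetraction (cornerRep i ⁅a, FreeLieAlgebra.of ℤ i⁆ 0 1) = a
  rw [LieHom.map_lie, ← ha, cornerRep_killLie, ha, cornerRep_of, if_pos rfl,
    LieRing.of_associative_ring_bracket, cornerHom_apply, Matrix.single_mul_single_same,
    Matrix.single_mul_single_of_ne _ _ _ _ (by decide), sub_zero, Matrix.single_apply_same, mul_one,
    assocRetraction_freeLieToAssoc]

theorem eq_zero_of_lie_of_eq_zero {i : Fin n} {a : FreeLie n} (ha : killLie i a = a)
    (h : ⁅a, FreeLieAlgebra.of ℤ i⁆ = 0) : a = 0 := by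
  rw [← contract_lie ha, h, map_zero]

/-- If `w` is a word in the `x_j` with `j < i`, then `⁅w, x_i⁆` is not deeper in the descending
central series than expected. -/
theorem mem_dcs_of_commutator_mem {i : Fin n} {w : FreeGroup (Fin n)} (hi : killGroup i w = w)
    (s : ℕ+) (h : ⁅w, FreeGroup.of i⁆ ∈ (dcs (FreeGroup (Fin n))).term (s + 1)) :
    w ∈ (dcs (FreeGroup (Fin n))).term s := by
  set Γ := dcs (FreeGroup (Fin n))
  induction s using PNat.recOn with
  | one => exact mem_dcs_one w
  | succ s ih =>
    have hw := ih (Γ.succ_le _ h)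
    set a := grToFreeLie (Γ.cls s w hw) with ha
    have hla : ⁅a, FreeLieAlgebra.of ℤ i⁆ = 0 := by
      refine freeLieToGr_injective ?_
      rw [LieHom.map_lie, map_zero, freeLieToGr_grToFreeLie, freeLieToGr_of, NSeries.lie_cls,
        NSeries.cls_eq_zero_iff]
      exact h
    have ha0 := eq_zero_of_lie_of_eq_zero (killLie_grToFreeLie_cls hw hi) hla
    rw [← Γ.cls_eq_zero_iff hw, ← freeLieToGr_grToFreeLie (Γ.cls s w hw), ha0, map_zero]

end Contract

section Triangular

variable {n : ℕ}

theorem alpha_apply_of (i j : Fin n) (h : j ≠ i) (r : Fin n) :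
    alpha i j h (FreeGroup.of r)
      = if r = i then FreeGroup.of j * FreeGroup.of r * (FreeGroup.of j)⁻¹ else FreeGroup.of r :=
  FreeGroup.lift_apply_of

theorem alpha_inv_apply_of (i j : Fin n) (h : j ≠ i) (r : Fin n) :
    (alpha i j h)⁻¹ (FreeGroup.of r)
      = if r = i then (FreeGroup.of j)⁻¹ * FreeGroup.of r * FreeGroup.of j else FreeGroup.of r := by
  have : (alpha i j h)⁻¹ (FreeGroup.of r)
      = if r = i then (FreeGroup.of j)⁻¹ * FreeGroup.of r * (FreeGroup.of j)⁻¹⁻¹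
        else FreeGroup.of r := FreeGroup.lift_apply_of
  rwa [inv_inv] at this

theorem alpha_mem (i j : Fin n) (h : j < i) : alpha i j h.ne ∈ upperMcCool n :=
  Subgroup.subset_closure ⟨i, j, h, rfl⟩

/-- `φ` sends `x_i` to a conjugate of `x_i` by an element of the subgroup generated by the `x_j`
with `j < i`. -/
def ConjBelow (φ : MulAut (FreeGroup (Fin n))) (i : Fin n) : Prop :=
  ∃ w, killGroup i w = w ∧ φ (FreeGroup.of i) = w * FreeGroup.of i * w⁻¹

theorem killGroup_apply {φ : MulAut (FreeGroup (Fin n))} {i : Fin n}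
    (h : ∀ j < i, ConjBelow φ j) {w : FreeGroup (Fin n)} (hw : killGroup i w = w) :
    killGroup i (φ w) = φ w := by
  suffices (killGroup i).comp (φ.toMonoidHom.comp (killGroup i))
      = φ.toMonoidHom.comp (killGroup i) by
    have h' := DFunLike.congr_fun this w
    change killGroup i (φ (killGroup i w)) = φ (killGroup i w) at h'
    rwa [hw] at h'
  ext j
  change killGroup i (φ (killGroup i (FreeGroup.of j))) = φ (killGroup i (FreeGroup.of j))
  rw [killGroup_of]
  split_ifs with hj
  · obtain ⟨u, hu, hφ⟩ := h j hj
    rw [hφ, map_mul, map_mul, map_inv, ← hu, killGroup_killGroup hj.le, killGroup_of, if_pos hj]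
  · rw [map_one, map_one]

/-- Elements of the upper triangular McCool group are triangular. -/
theorem conjBelow_of_mem {φ : MulAut (FreeGroup (Fin n))} (hφ : φ ∈ upperMcCool n) (i : Fin n) :
    ConjBelow φ i := by
  induction hφ using Subgroup.closure_induction generalizing i with
  | mem φ h =>
    obtain ⟨k, j, h, rfl⟩ := h
    by_cases hik : i = k
    · subst hik
      exact ⟨FreeGroup.of j, by rw [killGroup_of, if_pos h], by rw [alpha_apply_of, if_pos rfl]⟩
    · exact ⟨1, map_one _, by rw [alpha_apply_of, if_neg hik]; simp⟩
  | one => exact ⟨1, map_one _, by simp⟩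
  | mul φ ψ _ _ h h' =>
    obtain ⟨u, hu, hφ⟩ := h i
    obtain ⟨v, hv, hψ⟩ := h' i
    refine ⟨φ v * u, ?_, ?_⟩
    · rw [map_mul, hu, killGroup_apply (fun j _ => h j) hv]
    · rw [MulAut.mul_apply, hψ, map_mul, map_mul, hφ, map_inv]
      group
  | inv φ _ h =>
    induction i using WellFoundedLT.induction with
    | ind i ih =>
    obtain ⟨u, hu, hφ⟩ := h i
    refine ⟨(φ⁻¹ u)⁻¹, ?_, ?_⟩
    · rw [map_inv, killGroup_apply ih hu]
    · have h2 := congrArg (fun z => (φ⁻¹ u)⁻¹ * φ⁻¹ z * φ⁻¹ u) hφ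
      simp only [map_mul, map_inv, MulAut.inv_apply_self] at h2
      rw [inv_inv, h2]
      group

/-- The homomorphism `F_n → PΣ_n^+` sending `x_j` to `α_{ij}⁻¹` for `j < i`, and to `1`
otherwise. -/
def conjAut (i : Fin n) : FreeGroup (Fin n) →* upperMcCool n :=
  FreeGroup.lift fun j => if h : j < i then ⟨alpha i j h.ne, alpha_mem i j h⟩⁻¹ else 1

theorem conjAut_of (i j : Fin n) : conjAut i (FreeGroup.of j)
    = if h : j < i then ⟨alpha i j h.ne, alpha_mem i j h⟩⁻¹ else 1 :=
  FreeGroup.lift_apply_of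

theorem conjAut_apply_of_ne {i r : Fin n} (hr : r ≠ i) (w : FreeGroup (Fin n)) :
    (conjAut i w : MulAut (FreeGroup (Fin n))) (FreeGroup.of r) = FreeGroup.of r := by
  have h1 : ∀ j, (conjAut i (FreeGroup.of j) : MulAut (FreeGroup (Fin n))) (FreeGroup.of r)
      = FreeGroup.of r := by
    intro j
    rw [conjAut_of]
    split_ifs with h
    · rw [InvMemClass.coe_inv, alpha_inv_apply_of, if_neg hr]
    · rfl
  induction w using FreeGroup.induction_on with
  | C1 => rfl
  | of j => exact h1 j
  | inv_of j _ =>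
    rw [map_inv, InvMemClass.coe_inv]
    conv_lhs => rw [← h1 j]
    exact MulAut.inv_apply_self _ _ _
  | mul u v hu hv => rw [map_mul, Subgroup.coe_mul, MulAut.mul_apply, hv, hu]

theorem conjAut_apply_killGroup (i : Fin n) (w u : FreeGroup (Fin n)) :
    (conjAut i w : MulAut (FreeGroup (Fin n))) (killGroup i u) = killGroup i u := by
  suffices (conjAut i w : MulAut (FreeGroup (Fin n))).toMonoidHom.comp (killGroup i)
      = killGroup i from DFunLike.congr_fun this u
  ext j
  change (conjAut i w : MulAut (FreeGroup (Fin n))) (killGroup i (FreeGroup.of j)) = _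
  rw [killGroup_of]
  split_ifs with hj
  · exact conjAut_apply_of_ne hj.ne w
  · rw [map_one]

theorem conjAut_apply_self (i : Fin n) (w : FreeGroup (Fin n)) :
    (conjAut i w : MulAut (FreeGroup (Fin n))) (FreeGroup.of i)
      = (killGroup i w)⁻¹ * FreeGroup.of i * killGroup i w := by
  induction w using FreeGroup.induction_on with
  | C1 => simp
  | of j =>
    rw [conjAut_of, killGroup_of]
    split_ifs with h
    · rw [InvMemClass.coe_inv, alpha_inv_apply_of, if_pos rfl]
    · simp
  | inv_of j _ =>
    rw [map_inv, map_inv, conjAut_of, killGroup_of]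
    split_ifs with h
    · rw [inv_inv, inv_inv]
      exact (alpha_apply_of i j h.ne i).trans (if_pos rfl)
    · simp
  | mul u v hu hv =>
    rw [map_mul, Subgroup.coe_mul, MulAut.mul_apply, hv, map_mul, map_mul, map_inv, hu,
      conjAut_apply_killGroup, map_mul]
    group

end Triangular

/-! ### The additive retraction -/

section Retract

variable {n : ℕ}

/-- The word `w` in the `x_j` with `j < i` such that `φ` sends `x_i` to `w x_i w⁻¹`. -/
def conjWord (φ : upperMcCool n) (i : Fin n) : FreeGroup (Fin n) :=
  (conjBelow_of_mem φ.2 i).choose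

theorem killGroup_conjWord (φ : upperMcCool n) (i : Fin n) :
    killGroup i (conjWord φ i) = conjWord φ i :=
  (conjBelow_of_mem φ.2 i).choose_spec.1

theorem apply_of_eq_conjWord (φ : upperMcCool n) (i : Fin n) :
    φ.1 (FreeGroup.of i) = conjWord φ i * FreeGroup.of i * (conjWord φ i)⁻¹ :=
  (conjBelow_of_mem φ.2 i).choose_spec.2

theorem apply_of_mul_inv_eq_commutator (φ : upperMcCool n) (i : Fin n) :
    φ.1 (FreeGroup.of i) * (FreeGroup.of i)⁻¹ = ⁅conjWord φ i, FreeGroup.of i⁆ := by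
  rw [apply_of_eq_conjWord, commutatorElement_def]

/-- The descending central series of `PΣ_n^+` is contained in the Johnson filtration, so that
`⁅w, x_i⁆` lies in `Γ^{s+1}(F_n)` for a conjugating word `w` of an element of `Γ^s(PΣ_n^+)`. -/
theorem conjWord_mem {s : ℕ+} {φ : upperMcCool n} (hφ : φ ∈ (dcs (upperMcCool n)).term s)
    (i : Fin n) : conjWord φ i ∈ (dcs (FreeGroup (Fin n))).term s := by
  refine mem_dcs_of_commutator_mem (killGroup_conjWord φ i) s ?_
  rw [← apply_of_mul_inv_eq_commutator]
  exact johnson_apply_mem (dcs_upperMcCool_le s φ hφ) (mem_dcs_one _)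

variable (n) in
/-- The composite `⨁_s gr_s^{DCS}(PΣ_n^+) → ⨁_s gr_s^J(IA_n) → Der(L[V_n])`. -/
def mcCoolToDer : (dcs (upperMcCool n)).Gr →ₗ⁅ℤ⁆ gradedDer n :=
  (johnsonHom n).comp (mcCoolToJohnson n)

theorem mcCoolToDer_cls_apply_of {s : ℕ+} {φ : upperMcCool n}
    (hφ : φ ∈ (dcs (upperMcCool n)).term s) (i : Fin n) :
    (mcCoolToDer n ((dcs (upperMcCool n)).cls s φ hφ)).1 (FreeLieAlgebra.of ℤ i)
      = ⁅grToFreeLie ((dcs (FreeGroup (Fin n))).cls s (conjWord φ i) (conjWord_mem hφ i)),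
          FreeLieAlgebra.of ℤ i⁆ := by
  refine freeLieToGr_injective ?_
  change freeLieToGr n ((johnsonHom n (mcCoolToJohnson n _)).1 _) = _
  rw [mcCoolToJohnson, NSeries.map_cls, johnsonHom_isJohnsonHom, LieHom.map_lie,
    freeLieToGr_grToFreeLie, freeLieToGr_of, NSeries.lie_cls]
  exact NSeries.cls_congr _ rfl (apply_of_mul_inv_eq_commutator φ i) _ _

theorem conjAut_mem (i : Fin n) (s : ℕ+) : ∀ w ∈ (dcs (FreeGroup (Fin n))).term s,
    conjAut i w ∈ (dcs (upperMcCool n)).term s :=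
  dcs_map_mem _ (conjAut i) (fun _ => mem_dcs_one _) s

/-- The contribution of the generator `x_i` to the retraction `derRetraction`. -/
def derRetractionAt (i : Fin n) : gradedDer n →+ (dcs (upperMcCool n)).Gr :=
  AddMonoidHom.mk' (fun D => NSeries.map (conjAut i) (conjAut_mem i)
      (freeLieToGr n (contract i (D.1 (FreeLieAlgebra.of ℤ i))))) fun D E => by
    rw [← map_add, ← map_add, ← map_add, ← LieDerivation.add_apply]
    rfl

variable (n) in
/-- An additive retraction of `mcCoolToDer`: the value of a derivation on `x_i` is contracted to an
element of the free Lie algebra, which the homomorphism `conjAut i` maps to the graded ring of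
`PΣ_n^+`. The sign is there because `conjAut i w` conjugates `x_i` by `w⁻¹`. -/
def derRetraction : gradedDer n →+ (dcs (upperMcCool n)).Gr := -∑ i, derRetractionAt i

theorem derRetractionAt_mcCoolToDer_cls {s : ℕ+} {φ : upperMcCool n}
    (hφ : φ ∈ (dcs (upperMcCool n)).term s) (i : Fin n) :
    derRetractionAt i (mcCoolToDer n ((dcs (upperMcCool n)).cls s φ hφ))
      = (dcs (upperMcCool n)).cls s (conjAut i (conjWord φ i))
          (conjAut_mem i s _ (conjWord_mem hφ i)) := by
  change NSeries.map (conjAut i) (conjAut_mem i) (freeLieToGr n (contract i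
    ((mcCoolToDer n ((dcs (upperMcCool n)).cls s φ hφ)).1 (FreeLieAlgebra.of ℤ i)))) = _
  rw [mcCoolToDer_cls_apply_of, contract_lie (killLie_grToFreeLie_cls _ (killGroup_conjWord φ i)),
    freeLieToGr_grToFreeLie, NSeries.map_cls]

/-- An element of `PΣ_n^+` is the product of the automorphisms that conjugate a single generator
`x_i` by its conjugating word, in decreasing order of `i`; this is the statement about the classes
of these factors, with an induction over the generators moved by the product. -/
theorem exists_partial_product {s : ℕ+} {φ : upperMcCool n}
    (hφ : φ ∈ (dcs (upperMcCool n)).term s) (k : ℕ) (hk : k ≤ n) :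
    ∃ (ψ : upperMcCool n) (hψ : ψ ∈ (dcs (upperMcCool n)).term s),
      (dcs (upperMcCool n)).cls s ψ hψ
        = -∑ i with i.val < k, (dcs (upperMcCool n)).cls s (conjAut i (conjWord φ i))
          (conjAut_mem i s _ (conjWord_mem hφ i)) ∧
      ∀ i, ψ.1 (FreeGroup.of i) = if i.val < k then φ.1 (FreeGroup.of i) else FreeGroup.of i := by
  induction k with
  | zero =>
    refine ⟨1, one_mem _, ?_, ?_⟩
    · rw [NSeries.cls_one]
      simp
    · intro i
      simp
  | succ k ih =>
    obtain ⟨ψ, hψ, h1, h2⟩ := ih (by omega)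
    set m : Fin n := ⟨k, hk⟩ with hm
    have hmem := conjAut_mem m s _ (conjWord_mem hφ m)
    refine ⟨(conjAut m (conjWord φ m))⁻¹ * ψ, mul_mem (inv_mem hmem) hψ, ?_, ?_⟩
    · have hneg : (dcs (upperMcCool n)).cls s (conjAut m (conjWord φ m))⁻¹ (inv_mem hmem)
          = - (dcs (upperMcCool n)).cls s (conjAut m (conjWord φ m)) hmem := by
        rw [eq_neg_iff_add_eq_zero, ← NSeries.cls_mul _ (inv_mem hmem) hmem,
          NSeries.cls_congr _ rfl (inv_mul_cancel _) _ (one_mem _), NSeries.cls_one]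
      have hfilter : Finset.univ.filter (fun i : Fin n => i.val < k + 1)
          = insert m (Finset.univ.filter fun i : Fin n => i.val < k) := by
        ext i
        simp only [Finset.mem_filter, Finset.mem_univ, true_and, Finset.mem_insert, hm, Fin.ext_iff]
        omega
      rw [NSeries.cls_mul _ (inv_mem hmem) hψ, hneg, h1, hfilter,
        Finset.sum_insert (by simp [hm]), neg_add]
    · intro i
      have hstep : (((conjAut m (conjWord φ m))⁻¹ * ψ : upperMcCool n) :
          MulAut (FreeGroup (Fin n))) (FreeGroup.of i)
          = (conjAut m (conjWord φ m)⁻¹).1 (ψ.1 (FreeGroup.of i)) := by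
        rw [map_inv]; rfl
      rw [hstep, h2 i]
      rcases lt_trichotomy i.val k with h | h | h
      · have hiw : killGroup m (conjWord φ i) = conjWord φ i := by
          rw [← killGroup_conjWord φ i, killGroup_killGroup (Fin.mk_le_mk.2 h.le)]
        generalize (conjWord φ m)⁻¹ = v
        rw [if_pos h, if_pos (by omega), apply_of_eq_conjWord, map_mul, map_mul, map_inv, ← hiw,
          conjAut_apply_killGroup, conjAut_apply_of_ne (by rw [hm, Ne, Fin.ext_iff]; exact h.ne)]
      · obtain rfl : i = m := Fin.ext h
        rw [if_neg h.not_lt, if_pos (by omega), conjAut_apply_self, map_inv, killGroup_conjWord,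
          inv_inv, apply_of_eq_conjWord]
      · rw [if_neg (by omega), if_neg (by omega),
          conjAut_apply_of_ne (by rw [hm, Ne, Fin.ext_iff]; exact h.ne')]

theorem cls_eq_neg_sum {s : ℕ+} {φ : upperMcCool n} (hφ : φ ∈ (dcs (upperMcCool n)).term s) :
    (dcs (upperMcCool n)).cls s φ hφ
      = -∑ i, (dcs (upperMcCool n)).cls s (conjAut i (conjWord φ i))
          (conjAut_mem i s _ (conjWord_mem hφ i)) := by
  obtain ⟨ψ, hψ, h1, h2⟩ := exists_partial_product hφ n le_rfl
  have hψφ : ψ.1.toMonoidHom = φ.1.toMonoidHom := by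
    ext i
    exact (h2 i).trans (if_pos i.2)
  have h3 : ψ = φ := Subtype.ext (MulEquiv.toMonoidHom_injective hψφ)
  subst h3
  rw [h1, Finset.filter_true_of_mem fun i _ => i.2]

theorem derRetraction_mcCoolToDer (a : (dcs (upperMcCool n)).Gr) :
    derRetraction n (mcCoolToDer n a) = a := by
  induction a using NSeries.gr_induction with
  | zero => rw [map_zero, map_zero]
  | add a b ha hb => rw [map_add, map_add, ha, hb]
  | cls s φ hφ =>
    rw [derRetraction, AddMonoidHom.neg_apply, AddMonoidHom.finsetSum_apply, cls_eq_neg_sum hφ]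
    refine congrArg _ (Finset.sum_congr rfl fun i _ => ?_)
    rw [← cls_eq_neg_sum hφ, derRetractionAt_mcCoolToDer_cls]

/-- Derivations in the image of `mcCoolToDer` are triangular and tangential. -/
theorem exists_mcCoolToDer_apply_of (a : (dcs (upperMcCool n)).Gr) (i : Fin n) :
    ∃ u, killLie i u = u ∧
      (mcCoolToDer n a).1 (FreeLieAlgebra.of ℤ i) = ⁅u, FreeLieAlgebra.of ℤ i⁆ := by
  induction a using NSeries.gr_induction with
  | zero => exact ⟨0, map_zero _, by rw [map_zero, zero_lie]; rfl⟩
  | add a b ha hb =>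
    obtain ⟨u, hu, hu'⟩ := ha
    obtain ⟨v, hv, hv'⟩ := hb
    refine ⟨u + v, by rw [map_add, hu, hv], ?_⟩
    rw [map_add, add_lie, ← hu', ← hv']
    rfl
  | cls s φ hφ =>
    exact ⟨_, killLie_grToFreeLie_cls _ (killGroup_conjWord φ i), mcCoolToDer_cls_apply_of hφ i⟩

end Retract

/-! ### Derivations of the free Lie algebra -/

section DualNumbers

/-- The Lie ring `L ⊕ εL` of dual numbers over a Lie ring `L`, with `ε² = 0`. -/
def DualLie (L : Type*) : Type _ := L × L

variable {L : Type*} [LieRing L]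

instance : AddCommGroup (DualLie L) := inferInstanceAs (AddCommGroup (L × L))

instance : LieRing (DualLie L) where
  bracket a b := (⁅a.1, b.1⁆, ⁅a.1, b.2⁆ + ⁅a.2, b.1⁆)
  add_lie a b c := Prod.ext (add_lie a.1 b.1 c.1) <| by
    change ⁅a.1 + b.1, c.2⁆ + ⁅a.2 + b.2, c.1⁆
      = (⁅a.1, c.2⁆ + ⁅a.2, c.1⁆) + (⁅b.1, c.2⁆ + ⁅b.2, c.1⁆)
    rw [add_lie, add_lie]
    abel
  lie_add a b c := Prod.ext (lie_add a.1 b.1 c.1) <| by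
    change ⁅a.1, b.2 + c.2⁆ + ⁅a.2, b.1 + c.1⁆
      = (⁅a.1, b.2⁆ + ⁅a.2, b.1⁆) + (⁅a.1, c.2⁆ + ⁅a.2, c.1⁆)
    rw [lie_add, lie_add]
    abel
  lie_self a := Prod.ext (lie_self a.1) <| by
    change ⁅a.1, a.2⁆ + ⁅a.2, a.1⁆ = 0
    rw [← lie_skew, neg_add_cancel]
  leibniz_lie a b c := Prod.ext (leibniz_lie a.1 b.1 c.1) <| by
    change ⁅a.1, ⁅b.1, c.2⁆ + ⁅b.2, c.1⁆⁆ + ⁅a.2, ⁅b.1, c.1⁆⁆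
      = (⁅⁅a.1, b.1⁆, c.2⁆ + ⁅⁅a.1, b.2⁆ + ⁅a.2, b.1⁆, c.1⁆)
        + (⁅b.1, ⁅a.1, c.2⁆ + ⁅a.2, c.1⁆⁆ + ⁅b.2, ⁅a.1, c.1⁆⁆)
    rw [lie_add, lie_add, add_lie, leibniz_lie a.1 b.1 c.2, leibniz_lie a.1 b.2 c.1,
      leibniz_lie a.2 b.1 c.1]
    abel

variable {n : ℕ}

/-- The Lie algebra map `x_i ↦ x_i + ε f(i)` from the free Lie algebra to its dual numbers. -/
def dualHom (f : Fin n → FreeLie n) : FreeLie n →ₗ⁅ℤ⁆ DualLie (FreeLie n) :=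
  FreeLieAlgebra.lift ℤ fun i => ((FreeLieAlgebra.of ℤ i, f i) : FreeLie n × FreeLie n)

theorem dualHom_of (f : Fin n → FreeLie n) (i : Fin n) :
    dualHom f (FreeLieAlgebra.of ℤ i) = ((FreeLieAlgebra.of ℤ i, f i) : FreeLie n × FreeLie n) :=
  FreeLieAlgebra.lift_of_apply _ i

theorem dualHom_fst (f : Fin n → FreeLie n) (a : FreeLie n) : (dualHom f a).1 = a := by
  let p : DualLie (FreeLie n) →ₗ⁅ℤ⁆ FreeLie n :=
    { toLinearMap := (AddMonoidHom.fst (FreeLie n) (FreeLie n)).toIntLinearMap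
      map_lie' := rfl }
  suffices h : p.comp (dualHom f) = LieHom.id from LieHom.congr_fun h a
  ext i : 1
  exact congrArg Prod.fst (dualHom_of f i)

/-- The derivation of the free Lie algebra with prescribed values on the generators. -/
def freeLieDer (f : Fin n → FreeLie n) : LieDerivation ℤ (FreeLie n) (FreeLie n) where
  toLinearMap := (AddMonoidHom.mk' (fun a => (dualHom f a).2) fun a b => by
    rw [map_add]; rfl).toIntLinearMap
  leibniz' := by
    intro a b
    change (dualHom f ⁅a, b⁆).2 = ⁅a, (dualHom f b).2⁆ - ⁅b, (dualHom f a).2⁆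
    rw [LieHom.map_lie]
    change ⁅(dualHom f a).1, (dualHom f b).2⁆ + ⁅(dualHom f a).2, (dualHom f b).1⁆ = _
    rw [dualHom_fst, dualHom_fst, ← lie_skew b, sub_neg_eq_add]

theorem freeLieDer_of (f : Fin n → FreeLie n) (i : Fin n) :
    freeLieDer f (FreeLieAlgebra.of ℤ i) = f i :=
  congrArg Prod.snd (dualHom_of f i)

theorem lieDerivation_ext_of {D E : LieDerivation ℤ (FreeLie n) (FreeLie n)}
    (h : ∀ i, D (FreeLieAlgebra.of ℤ i) = E (FreeLieAlgebra.of ℤ i)) : D = E :=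
  LieDerivation.ext_of_lieSpan_eq_top _ (FreeLieAlgebra.lieSpan_range_of (Fin n)) <| by
    rintro _ ⟨i, rfl⟩
    exact h i

/-- A derivation that vanishes on `x_j` for `j < i` vanishes on the Lie subalgebra that these
generate. -/
theorem apply_eq_zero_of_killLie {D : LieDerivation ℤ (FreeLie n) (FreeLie n)} {i : Fin n}
    (h : ∀ j < i, D (FreeLieAlgebra.of ℤ j) = 0) {a : FreeLie n} (ha : killLie i a = a) :
    D a = 0 := by
  suffices h' : ∀ b, D (killLie i b) = 0 by rw [← ha, h']
  intro b
  have hb : b ∈ LieSubalgebra.lieSpan ℤ (FreeLie n) (Set.range (FreeLieAlgebra.of ℤ)) :=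
    FreeLieAlgebra.lieSpan_range_of (Fin n) ▸ LieSubalgebra.mem_top b
  induction hb using LieSubalgebra.lieSpan_induction with
  | mem x hx =>
    obtain ⟨j, rfl⟩ := hx
    rw [killLie_of]
    split_ifs with hj
    · exact h j hj
    · exact map_zero D
  | zero => rw [map_zero, map_zero]
  | add x y _ _ hx hy => rw [map_add, map_add, hx, hy, add_zero]
  | smul t x _ hx => rw [map_smul, map_smul, hx, smul_zero]
  | lie x y _ _ hx hy =>
    rw [LieHom.map_lie, LieDerivation.apply_lie_eq_add, hx, hy, lie_zero, zero_lie, add_zero]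

end DualNumbers

/-! ### There is no Lie algebra retraction -/

section SkewCoeff

attribute [local instance] LieRing.ofAssociativeRing

variable {n : ℕ}

/-- The coefficient of the word `x_i x_j` minus the coefficient of `x_j x_i`. -/
def skewCoeff (i j : Fin n) : FreeLie n →+ ℤ :=
  AddMonoidHom.mk' (fun a => (freeLieToAssoc a).coeff (FreeMonoid.ofList [i, j])
    - (freeLieToAssoc a).coeff (FreeMonoid.ofList [j, i])) fun a b => by
      simp only [map_add, MonoidAlgebra.coeff_add, Finsupp.add_apply]
      ring

theorem skewCoeff_apply (i j : Fin n) (a : FreeLie n) :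
    skewCoeff i j a = (freeLieToAssoc a).coeff (FreeMonoid.ofList [i, j])
    - (freeLieToAssoc a).coeff (FreeMonoid.ofList [j, i]) := rfl

/-- The coefficients of `x_i x_j x_i` in `x_i a` and `a x_i` are those of `x_j x_i` and `x_i x_j`
in `a`. -/
theorem skewCoeff_eq_zero {i j : Fin n} {a : FreeLie n} (h : ⁅FreeLieAlgebra.of ℤ i, a⁆ = 0) :
    skewCoeff i j a = 0 := by
  have h1 := congrArg (fun t => (freeLieToAssoc t).coeff (FreeMonoid.ofList [i, j, i])) h
  have e1 : FreeMonoid.ofList [i, j, i] = FreeMonoid.ofList [i] * FreeMonoid.ofList [j, i] := rfl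
  have e2 : FreeMonoid.ofList [i, j, i] = FreeMonoid.ofList [i, j] * FreeMonoid.ofList [i] := rfl
  simp only [LieHom.map_lie, freeLieToAssoc_of, LieRing.of_associative_ring_bracket,
    MonoidAlgebra.coeff_sub, Finsupp.sub_apply, map_zero, MonoidAlgebra.coeff_zero,
    Finsupp.zero_apply] at h1
  nth_rw 1 [e1] at h1
  rw [e2, word, MonoidAlgebra.coeff_single_mul_mul, MonoidAlgebra.coeff_mul_single_mul] at h1
  rw [skewCoeff_apply]
  linarith

theorem skewCoeff_swap (i j : Fin n) (a : FreeLie n) : skewCoeff i j a = -skewCoeff j i a := by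
  rw [skewCoeff_apply, skewCoeff_apply]
  ring

theorem skewCoeff_lie_of {i j : Fin n} (h : i ≠ j) :
    skewCoeff i j ⁅FreeLieAlgebra.of ℤ i, FreeLieAlgebra.of ℤ j⁆ = 2 := by
  have h1 : FreeMonoid.ofList [i, j] ≠ FreeMonoid.ofList [j, i] := by
    intro h'
    have := FreeMonoid.ofList.injective h'
    simp at this
    exact h this.1
  rw [skewCoeff_apply, LieHom.map_lie, freeLieToAssoc_of, freeLieToAssoc_of,
    LieRing.of_associative_ring_bracket, ← word_append, ← word_append]
  simp only [MonoidAlgebra.coeff_sub, Finsupp.sub_apply, List.cons_append, List.nil_append, word,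
    MonoidAlgebra.coeff_single, Finsupp.single_eq_same, Finsupp.single_eq_of_ne h1,
    Finsupp.single_eq_of_ne h1.symm]
  norm_num

/-- The Lie subalgebra generated by `x_i` alone is abelian. -/
theorem lie_eq_zero_of_killLie {i k : Fin n} (h : ∀ l < k, l = i) {a : FreeLie n}
    (ha : killLie k a = a) : ⁅FreeLieAlgebra.of ℤ i, a⁆ = 0 := by
  have h1 := apply_eq_zero_of_killLie
    (D := LieDerivation.inner ℤ (FreeLie n) (FreeLie n) (FreeLieAlgebra.of ℤ i)) (i := k)
    (fun l hl => by rw [h l hl, LieDerivation.inner_apply_apply, lie_self]) ha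
  rw [LieDerivation.inner_apply_apply] at h1
  rw [← lie_skew, h1, neg_zero]

/-- The derivation of the free Lie algebra with `x_i ↦ a` that vanishes on the other generators. -/
def genDer (i : Fin n) (a : FreeLie n) : LieDerivation ℤ (FreeLie n) (FreeLie n) :=
  freeLieDer (Pi.single i a)

theorem genDer_same (i : Fin n) (a : FreeLie n) : genDer i a (FreeLieAlgebra.of ℤ i) = a := by
  rw [genDer, freeLieDer_of, Pi.single_eq_same]

theorem genDer_of_ne {i j : Fin n} (h : j ≠ i) (a : FreeLie n) :
    genDer i a (FreeLieAlgebra.of ℤ j) = 0 := by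
  rw [genDer, freeLieDer_of, Pi.single_eq_of_ne h]

theorem genDer_mem {s : ℕ+} (i : Fin n) {a : FreeLie n} (ha : a ∈ freeLieDeg n (1 + s)) :
    genDer i a ∈ gradedDer n := by
  refine derDeg_le_gradedDer (mem_derDeg (s := s) fun j => ?_)
  rcases eq_or_ne j i with rfl | h
  · rwa [genDer_same]
  · rw [genDer_of_ne h]
    exact zero_mem _

/-- The image of the class of `α_{ij}` is the derivation `x_i ↦ ⁅x_j, x_i⁆`. -/
theorem mcCoolToDer_cls_alpha {i j : Fin n} (h : j < i) :
    (mcCoolToDer n ((dcs (upperMcCool n)).cls 1 ⟨alpha i j h.ne, alpha_mem i j h⟩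
      (mem_dcs_one _))).1 = genDer i ⁅FreeLieAlgebra.of ℤ j, FreeLieAlgebra.of ℤ i⁆ := by
  refine lieDerivation_ext_of fun k => freeLieToGr_injective ?_
  change freeLieToGr n ((johnsonHom n (mcCoolToJohnson n _)).1 _) = _
  rw [mcCoolToJohnson, NSeries.map_cls, johnsonHom_isJohnsonHom]
  rcases eq_or_ne k i with rfl | hk
  · rw [genDer_same, LieHom.map_lie, freeLieToGr_of, freeLieToGr_of, NSeries.lie_cls]
    refine NSeries.cls_congr _ rfl ?_ _ _
    change alpha k j h.ne (FreeGroup.of k) * _ = _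
    rw [alpha_apply_of, if_pos rfl, commutatorElement_def]
  · rw [genDer_of_ne hk, map_zero]
    refine (NSeries.cls_congr _ rfl (y := 1) ?_ _ (one_mem _)).trans (NSeries.cls_one _ _)
    change alpha i j h.ne (FreeGroup.of k) * _ = _
    rw [alpha_apply_of, if_neg hk, mul_inv_cancel]

end SkewCoeff

section NotSplit

variable {n : ℕ} {i j k : Fin n}

local notation "x_" i => (FreeLieAlgebra.of ℤ i : FreeLie _)

theorem genDer_lie_genDer (hik : i ≠ k) (hjk : j ≠ k) :
    ⁅genDer k ⁅x_ i, x_ k⁆, genDer k ⁅x_ j, x_ k⁆⁆ = -genDer k ⁅⁅x_ i, x_ j⁆, x_ k⁆ := by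
  refine lieDerivation_ext_of fun r => ?_
  rw [LieDerivation.commutator_apply, LieDerivation.neg_apply]
  rcases eq_or_ne r k with rfl | hr
  · simp only [genDer_same, LieDerivation.apply_lie_eq_add, genDer_of_ne hjk, genDer_of_ne hik,
      zero_lie, add_zero, lie_lie]
    abel
  · simp only [genDer_of_ne hr, map_zero, sub_zero, neg_zero]

theorem genDer_add_lie_genDer_add (hij : i ≠ j) (hik : i ≠ k) (hjk : j ≠ k) :
    ⁅genDer j ⁅x_ i, x_ j⁆ + genDer k ⁅x_ i, x_ k⁆, genDer i ⁅x_ j, x_ i⁆ + genDer k ⁅x_ j, x_ k⁆⁆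
      = genDer i ⁅⁅x_ i, x_ j⁆, x_ i⁆ + genDer j ⁅⁅x_ i, x_ j⁆, x_ j⁆
        + genDer k ⁅⁅x_ i, x_ j⁆, x_ k⁆ := by
  refine lieDerivation_ext_of fun r => ?_
  simp only [LieDerivation.commutator_apply, LieDerivation.add_apply]
  rcases eq_or_ne r i with rfl | hi
  · simp only [genDer_same, genDer_of_ne hij, genDer_of_ne hik, LieDerivation.apply_lie_eq_add,
      map_zero, lie_zero, zero_lie, add_zero, zero_add, sub_zero, genDer_of_ne hjk]
  rcases eq_or_ne r j with rfl | hj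
  · simp only [genDer_same, genDer_of_ne hij.symm, genDer_of_ne hjk, genDer_of_ne hik,
      LieDerivation.apply_lie_eq_add, map_zero, lie_zero, zero_lie, add_zero, zero_add, zero_sub]
    rw [← neg_lie, lie_skew]
  rcases eq_or_ne r k with rfl | hk
  · simp only [genDer_same, genDer_of_ne hjk, genDer_of_ne hik, genDer_of_ne hik.symm,
      genDer_of_ne hjk.symm, LieDerivation.apply_lie_eq_add, lie_zero, zero_lie, add_zero, zero_add]
    rw [← lie_skew (x_ i) (x_ j), neg_lie, lie_lie]
    abel
  · simp only [genDer_of_ne hi, genDer_of_ne hj, genDer_of_ne hk, map_zero, add_zero, sub_zero]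

/-- Derivations that move different generators commute if each of them kills the value of the
other. -/
theorem genDer_lie_genDer_eq_zero {a b : FreeLie n} (hik : i ≠ k)
    (ha : genDer k b a = 0) (hb : genDer i a b = 0) : ⁅genDer i a, genDer k b⁆ = 0 := by
  refine lieDerivation_ext_of fun r => ?_
  rw [LieDerivation.commutator_apply, LieDerivation.zero_apply]
  rcases eq_or_ne r i with rfl | hi
  · rw [genDer_of_ne hik, genDer_same, map_zero, ha, sub_zero]
  rcases eq_or_ne r k with rfl | hk
  · rw [genDer_of_ne hik.symm, genDer_same, map_zero, hb, sub_zero]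
  · rw [genDer_of_ne hi, genDer_of_ne hk, map_zero, map_zero, sub_zero]

/-- The derivations that occur in the image of `mcCoolToDer`: each `x_i` is sent to `⁅u, x_i⁆` with
`u` in the Lie subalgebra generated by the `x_j` with `j < i`. -/
def IsTriangular (D : LieDerivation ℤ (FreeLie n) (FreeLie n)) : Prop :=
  ∀ i, ∃ u, killLie i u = u ∧ D (x_ i) = ⁅u, x_ i⁆

theorem IsTriangular.apply_first {D : LieDerivation ℤ (FreeLie n) (FreeLie n)}
    (hD : IsTriangular D) (hi : ∀ l, ¬ l < i) : D (x_ i) = 0 := by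
  obtain ⟨u, hu, h⟩ := hD i
  have hu0 := apply_eq_zero_of_killLie
    (D := LieDerivation.inner ℤ (FreeLie n) (FreeLie n) (x_ i)) (fun l hl => absurd hl (hi l)) hu
  rw [LieDerivation.inner_apply_apply] at hu0
  rw [h, hu0]

/-- A triangular derivation commuting with `x_k ↦ ⁅x_j, x_k⁆`, where `x_i, x_j, x_k` are the first
three generators, sends `x_k` to `⁅u, x_k⁆` where `u` has no component along `⁅x_i, x_j⁆`. -/
theorem skewCoeff_of_lie_genDer_second (hjk : j < k) (hj : ∀ l < j, l = i)
    {D : LieDerivation ℤ (FreeLie n) (FreeLie n)}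
    (hD : IsTriangular D) (h : ⁅D, genDer k ⁅x_ j, x_ k⁆⁆ = 0) {u : FreeLie n}
    (hu : killLie k u = u) (hDu : D (x_ k) = ⁅u, x_ k⁆) : skewCoeff i j u = 0 := by
  obtain ⟨v, hv, hDv⟩ := hD j
  have hEu : genDer k ⁅x_ j, x_ k⁆ u = 0 :=
    apply_eq_zero_of_killLie (fun l hl => genDer_of_ne hl.ne _) hu
  have h1 := LieDerivation.congr_fun h (x_ k)
  rw [LieDerivation.commutator_apply, LieDerivation.zero_apply, genDer_same, hDu,
    LieDerivation.apply_lie_eq_add, LieDerivation.apply_lie_eq_add, hEu, zero_lie, add_zero,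
    genDer_same, hDv, hDu] at h1
  have h2 : ⁅⁅v, x_ j⁆ + ⁅x_ j, u⁆, x_ k⁆ = 0 := by
    rw [← h1, add_lie, lie_lie (x_ j) u]
    abel
  have hvk : killLie k v = v := by rw [← hv, killLie_killLie hjk.le]
  have h3 := eq_zero_of_lie_of_eq_zero
    (by rw [map_add, LieHom.map_lie, LieHom.map_lie, hvk, hu, killLie_of, if_pos hjk]) h2
  have h4 : ⁅x_ j, u - v⁆ = 0 := by
    rw [← h3, lie_sub, ← lie_skew v]
    abel
  have h5 := skewCoeff_eq_zero (j := i) h4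
  have h6 := skewCoeff_eq_zero (j := j) (lie_eq_zero_of_killLie hj hv)
  rw [map_sub, skewCoeff_swap j i v, h6, neg_zero, sub_zero] at h5
  rw [skewCoeff_swap, h5, neg_zero]

/-- The analogue of `skewCoeff_of_lie_genDer_second` for `x_k ↦ ⁅x_i, x_k⁆`. -/
theorem skewCoeff_of_lie_genDer_first (hik : i < k) (hi : ∀ l, ¬ l < i)
    {D : LieDerivation ℤ (FreeLie n) (FreeLie n)}
    (hD : IsTriangular D) (h : ⁅D, genDer k ⁅x_ i, x_ k⁆⁆ = 0) {u : FreeLie n}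
    (hu : killLie k u = u) (hDu : D (x_ k) = ⁅u, x_ k⁆) : skewCoeff i j u = 0 := by
  have hEu : genDer k ⁅x_ i, x_ k⁆ u = 0 :=
    apply_eq_zero_of_killLie (fun l hl => genDer_of_ne hl.ne _) hu
  have h1 := LieDerivation.congr_fun h (x_ k)
  rw [LieDerivation.commutator_apply, LieDerivation.zero_apply, genDer_same, hDu,
    LieDerivation.apply_lie_eq_add, LieDerivation.apply_lie_eq_add, hEu, zero_lie, add_zero,
    genDer_same, hD.apply_first hi, zero_lie, add_zero, hDu] at h1
  have h2 : ⁅⁅x_ i, u⁆, x_ k⁆ = 0 := by rw [← h1, lie_lie]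
  exact skewCoeff_eq_zero (eq_zero_of_lie_of_eq_zero
    (by rw [LieHom.map_lie, hu, killLie_of, if_pos hik]) h2)

/-- On the subalgebra generated by the first three generators `x_i, x_j, x_k`, the derivation
`x_j ↦ ⁅x_i, x_j⁆`, `x_k ↦ ⁅x_i, x_k⁆` is the inner derivation given by `x_i`, which triangular
derivations annihilate. -/
theorem lie_triangular_apply (hij : i < j) (hjk : j < k) (hi : ∀ l, ¬ l < i)
    (hk : ∀ l < k, l = i ∨ l = j)
    {D : LieDerivation ℤ (FreeLie n) (FreeLie n)} (hD : IsTriangular D) :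
    ⁅genDer j ⁅x_ i, x_ j⁆ + genDer k ⁅x_ i, x_ k⁆, D⁆ (x_ k) = 0 := by
  obtain ⟨v, hv, hDv⟩ := hD k
  set E := genDer j ⁅x_ i, x_ j⁆ + genDer k ⁅x_ i, x_ k⁆ with hE
  have hEk : E (x_ k) = ⁅x_ i, x_ k⁆ := by
    rw [hE, LieDerivation.add_apply, genDer_of_ne hjk.ne', genDer_same, zero_add]
  have hEv : E v = ⁅x_ i, v⁆ := by
    have h := apply_eq_zero_of_killLie
      (D := E + LieDerivation.inner ℤ (FreeLie n) (FreeLie n) (x_ i)) (fun l hl => ?_) hv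
    · rw [LieDerivation.add_apply, LieDerivation.inner_apply_apply] at h
      rw [← lie_skew, eq_neg_iff_add_eq_zero, h]
    · rw [LieDerivation.add_apply, LieDerivation.inner_apply_apply, hE, LieDerivation.add_apply,
        genDer_of_ne hl.ne, add_zero]
      rcases hk l hl with rfl | rfl
      · rw [genDer_of_ne hij.ne, lie_self, add_zero]
      · rw [genDer_same, ← lie_skew, neg_add_cancel]
  rw [LieDerivation.commutator_apply, hDv, hEk, LieDerivation.apply_lie_eq_add,
    LieDerivation.apply_lie_eq_add, hEk, hEv, hDv, hD.apply_first hi, zero_lie, add_zero, lie_lie]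
  abel

/-- `mcCoolToDer` has no retraction that is a map of Lie algebras when `n ≥ 3`. -/
theorem not_exists_lie_retraction (hn : 3 ≤ n) :
    ¬ ∃ r : gradedDer n →ₗ⁅ℤ⁆ (dcs (upperMcCool n)).Gr, ∀ a, r (mcCoolToDer n a) = a := by
  rintro ⟨r, hr⟩
  obtain ⟨i, hi⟩ : ∃ i : Fin n, i.val = 0 := ⟨⟨0, by omega⟩, rfl⟩
  obtain ⟨j, hj⟩ : ∃ j : Fin n, j.val = 1 := ⟨⟨1, by omega⟩, rfl⟩
  obtain ⟨k, hk⟩ : ∃ k : Fin n, k.val = 2 := ⟨⟨2, by omega⟩, rfl⟩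
  have hij : i < j := by rw [Fin.lt_def]; omega
  have hik : i < k := by rw [Fin.lt_def]; omega
  have hjk : j < k := by rw [Fin.lt_def]; omega
  have hi' : ∀ l, ¬ l < i := fun l h => by rw [Fin.lt_def] at h; omega
  have hj' : ∀ l < j, l = i := fun l h => by rw [Fin.lt_def] at h; exact Fin.ext (by omega)
  have hk' : ∀ l < k, l = i ∨ l = j := fun l h => by
    rw [Fin.lt_def] at h; rw [Fin.ext_iff, Fin.ext_iff]; omega
  let ρ : gradedDer n →ₗ⁅ℤ⁆ gradedDer n := (mcCoolToDer n).comp r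
  have hT : ∀ D, IsTriangular (ρ D).1 := fun D => exists_mcCoolToDer_apply_of (r D)
  have hfix : ∀ a, ρ (mcCoolToDer n a) = mcCoolToDer n a := fun a => by
    change mcCoolToDer n (r (mcCoolToDer n a)) = _
    rw [hr]
  have m2 : ∀ a b : Fin n, ⁅x_ a, x_ b⁆ ∈ freeLieDeg n (1 + 1) := fun a b =>
    lie_mem_freeLieDeg (of_mem_freeLieDeg a) (of_mem_freeLieDeg b)
  have m3 : ∀ a b c : Fin n, ⁅⁅x_ a, x_ b⁆, x_ c⁆ ∈ freeLieDeg n (1 + (1 + 1)) := fun a b c =>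
    add_assoc (1 : ℕ+) 1 1 ▸ lie_mem_freeLieDeg (m2 a b) (of_mem_freeLieDeg c)
  -- `E a b` is the class of `α_{ba}` when `a < b`; the relation `hsum` also needs `E j i`.
  let E : Fin n → Fin n → gradedDer n := fun a b =>
    ⟨genDer b ⁅x_ a, x_ b⁆, genDer_mem b (m2 a b)⟩
  let Y : Fin n → gradedDer n := fun c =>
    ⟨genDer c ⁅⁅x_ i, x_ j⁆, x_ c⁆, genDer_mem c (m3 i j c)⟩
  have hfixE : ∀ a b, a < b → ρ (E a b) = E a b := fun a b h => by
    have e : E a b = mcCoolToDer n ((dcs (upperMcCool n)).cls 1 ⟨alpha b a h.ne, alpha_mem b a h⟩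
      (mem_dcs_one _)) := Subtype.ext (mcCoolToDer_cls_alpha h).symm
    rw [e, hfix]
  have hYk : ⁅E i k, E j k⁆ = -Y k := Subtype.ext (genDer_lie_genDer hik.ne hjk.ne)
  have hfixY : ρ (Y k) = Y k := by
    rw [← neg_inj, ← map_neg, ← hYk, LieHom.map_lie, hfixE i k hik, hfixE j k hjk]
  have hsum : ⁅E i j + E i k, E j i + E j k⁆ = Y i + Y j + Y k :=
    Subtype.ext (genDer_add_lie_genDer_add hij.ne hik.ne hjk.ne)
  have hci : ⁅Y i, E j k⁆ = 0 := Subtype.ext <| genDer_lie_genDer_eq_zero hik.ne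
    (by simp only [LieDerivation.apply_lie_eq_add, genDer_of_ne hik.ne, genDer_of_ne hjk.ne,
      lie_zero, zero_lie, add_zero])
    (by simp only [LieDerivation.apply_lie_eq_add, genDer_of_ne hij.ne', genDer_of_ne hik.ne',
      lie_zero, zero_lie, add_zero])
  have hcj : ⁅Y j, E i k⁆ = 0 := Subtype.ext <| genDer_lie_genDer_eq_zero hjk.ne
    (by simp only [LieDerivation.apply_lie_eq_add, genDer_of_ne hik.ne, genDer_of_ne hjk.ne,
      lie_zero, zero_lie, add_zero])
    (by simp only [LieDerivation.apply_lie_eq_add, genDer_of_ne hij.ne, genDer_of_ne hjk.ne',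
      lie_zero, zero_lie, add_zero])
  obtain ⟨u, hu, hDu⟩ := hT (Y i) k
  obtain ⟨v, hv, hDv⟩ := hT (Y j) k
  -- Applying the Lie map `ρ`, which fixes `E i k` and `E j k`, preserves the commutation relations.
  have hu0 : skewCoeff i j u = 0 := by
    refine skewCoeff_of_lie_genDer_second hjk hj' (hT (Y i)) ?_ hu hDu
    have h := congrArg ρ hci
    rw [LieHom.map_lie, hfixE j k hjk, map_zero] at h
    exact congrArg Subtype.val h
  have hv0 : skewCoeff i j v = 0 := by
    refine skewCoeff_of_lie_genDer_first hik hi' (hT (Y j)) ?_ hv hDv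
    have h := congrArg ρ hcj
    rw [LieHom.map_lie, hfixE i k hik, map_zero] at h
    exact congrArg Subtype.val h
  have h1 := congrArg ρ hsum
  rw [LieHom.map_lie, map_add ρ (E i j), hfixE i j hij, hfixE i k hik, map_add ρ (Y i + Y j),
    map_add ρ (Y i), hfixY] at h1
  have h2 := LieDerivation.congr_fun (congrArg Subtype.val h1) (x_ k)
  have h3 : ⁅genDer j ⁅x_ i, x_ j⁆ + genDer k ⁅x_ i, x_ k⁆, (ρ (E j i + E j k)).1⁆ (x_ k)
      = (ρ (Y i)).1 (x_ k) + (ρ (Y j)).1 (x_ k) + genDer k ⁅⁅x_ i, x_ j⁆, x_ k⁆ (x_ k) := h2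
  rw [lie_triangular_apply hij hjk hi' hk' (hT _), hDu, hDv, genDer_same, ← add_lie,
    ← add_lie] at h3
  have h4 := eq_zero_of_lie_of_eq_zero (by
    rw [map_add, map_add, hu, hv, LieHom.map_lie, killLie_of, killLie_of, if_pos hik, if_pos hjk])
    h3.symm
  have h5 := congrArg (skewCoeff i j) h4
  rw [map_add, map_add, hu0, hv0, skewCoeff_lie_of hij.ne, map_zero] at h5
  norm_num at h5

end NotSplit

end

/-- `J` is the composite `⨁_s gr_s^{DCS}(PΣ_n^+) → ⨁_s gr_s^J(IA_n) → Der(L[V_n])`. The first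
conjunct is the identification `L[V_n] ≅ gr_*^{DCS}(F_n)`, through which the Johnson homomorphisms
take values in `L[V_n]`; it shows that `τ` is uniquely determined by `IsJohnsonHom n τ`. -/
theorem mainTheorem5 (n : ℕ) :
    Function.Bijective (freeLieToGr n) ∧
    ∃ τ : (johnson (FreeGroup (Fin n))).Gr →ₗ⁅ℤ⁆ gradedDer n,
      IsJohnsonHom n τ ∧
      ∃ J : (dcs (upperMcCool n)).Gr →ₗ⁅ℤ⁆ gradedDer n,
        J = τ.comp (mcCoolToJohnson n) ∧
        Function.Injective J ∧
        (∃ r : gradedDer n →+ (dcs (upperMcCool n)).Gr, ∀ a, r (J a) = a) ∧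
        (3 ≤ n → ¬ ∃ r : gradedDer n →ₗ⁅ℤ⁆ (dcs (upperMcCool n)).Gr, ∀ a, r (J a) = a) :=
  ⟨freeLieToGr_bijective, johnsonHom n, johnsonHom_isJohnsonHom, mcCoolToDer n, rfl,
    Function.LeftInverse.injective derRetraction_mcCoolToDer,
    ⟨derRetraction n, derRetraction_mcCoolToDer⟩, not_exists_lie_retraction⟩
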